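/- Let $s\ge 1$, let $\mathcal K$ be a finite set, and let $\alpha_{i,\kappa}\ge 0$, $\varpi_i>0$ for $1\le i\le s$, $\kappa\in\mathcal K$. Let $\Delta,D,\nu,c>0$. Write $\mathbb N=\{1,2,\dots\}$ and let $|\cdot|$ denote the maximum norm of a vector. **The functions.** For $f:\mathbb N^s\to\mathbb R_{\ge 0}$, real numbers $C_{f,M},C_{f,E}$ and numbers $C_{f,M,I}(\mathbf z)$ (for $\emptyset\ne I\subsetneq\{1,\dots,s\}$ and $\mathbf z\in\mathbb N^I$), consider the following conditions. * (Property I) $0\le C_{f,M}\le C_{f,E}$, and for all real $B_1,\dots,B_s\ge 1$ $$\Bigl|\sum_{1\le y_i\le B_i\ \forall i} f(\mathbf y)-C_{f,M}\prod_{i=1}^s B_i^{\varpi_i}\Bigr|\le c\,C_{f,E}\prod_{i=1}^s B_i^{\varpi_i}\,\bigl(\min_i B_i\bigr)^{-\Delta}.$$ * (Property II) For all $\emptyset\ne I\subsetneq\{1,\dots,s\}$ and $\mathbf z\in\mathbb N^I$ one has $C_{f,M,I}(\mathbf z)\ge 0$, and for all real $B_i\ge 1$ $(i\notin I)$ with $|\mathbf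 z|\le\bigl(\prod_{i\notin I}B_i\bigr)^{\nu}$ $$\Bigl|\sum_{\substack{1\le y_i\le B_i\ \forall i\notin I\\ y_i=z_i\ \forall i\in I}} f(\mathbf y)-C_{f,M,I}(\mathbf z)\prod_{i\notin I} B_i^{\varpi_i}\Bigr|\le c\,C_{f,E}\,|\mathbf z|^{D}\prod_{i\notin I} B_i^{\varpi_i}\,\bigl(\min_{i\notin I} B_i\bigr)^{-\Delta}.$$ * (Bound on the constants) $C_{f,M,I}(\mathbf z)\le C_{f,E}|\mathbf z|^{D}$ for all such $I$ and $\mathbf z$. **The polytope.** Let $$\mathcal P=\Bigl\{t\in\mathbb R^s:\ t_i\ge 0\ \forall i,\ \ \sum_{i=1}^s\alpha_{i,\kappa}\varpi_i^{-1}t_i\le 1\ \ \forall \kappa\in\mathcal K\Bigr\}.$$ Assume that $\mathcal P$ is bounded and non-degenerate (its affine span is $\mathbb R^s$). Let $a$ be the maximum of $\sum_i t_i$ on $\mathcal P$, let $F$ be the face of $\mathcal P$ where it is attained, and let $k=\dim F$. Assume that $F$ is not contained in a coordinate hyperplane $\{t_i=0\}$. **The geometric assumption.** For $B>1$, $\emptyset\ne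 J\subsetneq\{1,\dots,s\}$ and $\mathbf y=(y_i)_{i\notin J}\in\mathbb N^{J^c}$ let $\mathcal P^J(\mathbf y)\subset\mathbb R^J$ be the set of all $t\ge 0$ with $$\sum_{i\in J}\alpha_{i,\kappa}\varpi_i^{-1}t_i\le\frac{\log\bigl(B\prod_{i\notin J}y_i^{-\alpha_{i,\kappa}}\bigr)}{\log B}\qquad\forall\kappa\in\mathcal K,$$ let $a_J(\mathbf y)$ be the maximum of $\sum_{i\in J}t_i$ on $\mathcal P^J(\mathbf y)$, and let $k_J(\mathbf y)$ be the dimension of the face where it is attained. For real $N,C_{10}$ let $\mathrm{A}(N,C_{10})$ be the following condition: for all sufficiently large $B$, all $\emptyset\ne J\subsetneq\{1,\dots,s\}$ and all $\mathbf y\in\mathbb N^{J^c}$ with $y_i\le(\log B)^N$ for all $i\notin J$, if $a_J(\mathbf y)\ge a-C_{10}\frac{\log\log B}{\log B}$, then $k_J(\mathbf y)\le k-1$. **Theorem.** There is a real number $c_P$ such that, for some $C'$ and all sufficiently small $\delta>0$, $$\Bigl|\operatorname{meas}_{s-1}\Bigl(\mathcal P\cap\Bigl\{\sum_i t_i=a-\delta\Bigr\}\Bigr)-c_P\,\delta^{s-1-k}\Bigr|\le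 C'\delta^{s-k},$$ where $\operatorname{meas}_{s-1}$ is the Lebesgue measure of the image under any one of the $s$ projections that forget one coordinate. (This determines $c_P$ uniquely.) Moreover there is $N_0$, depending only on the data $s,\mathcal K,\alpha,\varpi,\Delta,D,\nu,c$, such that the following holds. Let $N\ge N_0$ and $C_{10}>Ns$, and suppose that $\mathrm A(N,C_{10})$ holds. Then there are $C$ and $B_0$ such that for every $f:\mathbb N^s\to\mathbb R_{\ge 0}$ that satisfies Property I, Property II and the bound on the constants with some $C_{f,M}$, $C_{f,E}$, $C_{f,M,I}(\cdot)$, and every $B\ge B_0$, the sum $$S^f=\sum_{\substack{\mathbf y\in\mathbb N^s\\ \prod_i y_i^{\alpha_{i,\kappa}}\le B\ \forall\kappa\in\mathcal K}}f(\mathbf y)$$ is finite (it has finitely many terms) and $$\Bigl|S^f-(s-1-k)!\,C_{f,M}\,c_P\,(\log B)^kB^a\Bigr|\le C\,C_{f,E}\,(\log\log B)^s(\log B)^{k-1}B^a.$$ In particular $C$ and $B_0$ do not depend on $f$, $C_{f,M}$, $C_{f,E}$ or $C_{f,M,I}$. -/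

import Mathlib

namespace HyperbolaMethod

noncomputable section

/-- The polyhedron of all `t` with `∑ i, α i k * (ϖ i)⁻¹ * t i ≤ b k` for all `k`, and `t i ≥ 0`
for all `i`. -/
def polyhedron {ι κ : Type*} [Fintype ι] (α : ι → κ → ℝ) (ϖ : ι → ℝ) (b : κ → ℝ) :
    Set (ι → ℝ) :=
  {t | (∀ k, ∑ i, α i k * (ϖ i)⁻¹ * t i ≤ b k) ∧ ∀ i, 0 ≤ t i}

/-- The maximal value of the linear form `∑ i, t i` on `P` (attained when `P` is a nonempty
compact set, as is the case for the polytopes below). -/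
def maxValue {ι : Type*} [Fintype ι] (P : Set (ι → ℝ)) : ℝ :=
  sSup ((fun t : ι → ℝ => ∑ i, t i) '' P)

/-- The face of `P` on which `∑ i, t i` takes its maximal value. -/
def maxFace {ι : Type*} [Fintype ι] (P : Set (ι → ℝ)) : Set (ι → ℝ) :=
  {t | t ∈ P ∧ ∑ i, t i = maxValue P}

/-- The (affine) dimension of the face on which `∑ i, t i` is maximal. -/
def maxFaceDim {ι : Type*} [Fintype ι] (P : Set (ι → ℝ)) : ℕ :=
  Module.finrank ℝ (vectorSpan ℝ (maxFace P))

/-- The `(s-1)`-dimensional measure of the intersection of `P` with the hyperplane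
`∑ i, t i = c`, i.e. the Lebesgue measure of its image under the coordinate projection that
forgets the coordinate `i₀`. It does not depend on `i₀`. -/
def sliceMeasure {s : ℕ} (P : Set (Fin s → ℝ)) (i₀ : Fin s) (c : ℝ) : ℝ :=
  (MeasureTheory.volume : MeasureTheory.Measure ({j : Fin s // j ≠ i₀} → ℝ)).real
    ((fun (t : Fin s → ℝ) (j : {j : Fin s // j ≠ i₀}) => t j) ''
      {t | t ∈ P ∧ ∑ i, t i = c})

/-- `c` is the leading constant of the volume of the slices of `P` near the maximal face: with
`a` the maximal value of `∑ i, t i` on `P` and `k` the dimension of the maximal face, the measure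
of `P ∩ {∑ i, t i = a - δ}` is `c * δ ^ (s-1-k) + O(δ ^ (s-k))` for all small `δ > 0`.
For `k ≤ s - 1` this determines `c` uniquely. -/
def IsSliceConstant {s : ℕ} (P : Set (Fin s → ℝ)) (c : ℝ) : Prop :=
  ∃ C δ₀ : ℝ, 0 < δ₀ ∧ ∀ i₀ : Fin s, ∀ δ : ℝ, 0 < δ → δ < δ₀ →
    |sliceMeasure P i₀ (maxValue P - δ) - c * δ ^ (s - 1 - maxFaceDim P)|
      ≤ C * δ ^ (s - maxFaceDim P)

/-- Property I, with implied constant `c`: asymptotics for the sums of `f` over all boxes. -/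
def PropertyI {s : ℕ} (ϖ : Fin s → ℝ) (Δ c : ℝ) (f : (Fin s → ℕ+) → ℝ) (CM CE : ℝ) : Prop :=
  0 ≤ CM ∧ CM ≤ CE ∧ ∀ B : Fin s → ℝ, (∀ i, 1 ≤ B i) →
    |(∑ᶠ y ∈ {y : Fin s → ℕ+ | ∀ i, ((y i : ℕ) : ℝ) ≤ B i}, f y) - CM * ∏ i, B i ^ ϖ i|
      ≤ c * (CE * (∏ i, B i ^ ϖ i) * (⨅ i, B i) ^ (-Δ))

/-- Property II, with implied constant `c`: asymptotics for the sums of `f` over the boxes in the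
variables `y i`, `i ∉ I`, when the vector `z` of the variables with index in the nonempty proper
subset `I` is fixed, uniformly in `‖z‖ ≤ (∏ i ∉ I, B i) ^ ν` where `‖z‖` is the maximum norm. -/
def PropertyII {s : ℕ} (ϖ : Fin s → ℝ) (Δ D ν c : ℝ) (f : (Fin s → ℕ+) → ℝ) (CE : ℝ)
    (CMI : (I : Finset (Fin s)) → (I → ℕ+) → ℝ) : Prop :=
  ∀ I : Finset (Fin s), I.Nonempty → I ≠ Finset.univ → ∀ z : I → ℕ+,
    0 ≤ CMI I z ∧ ∀ B : Fin s → ℝ, (∀ i ∉ I, 1 ≤ B i) →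
      ‖(fun i : I => ((z i : ℕ) : ℝ))‖ ≤ (∏ i ∈ Iᶜ, B i) ^ ν →
      |(∑ᶠ y ∈ {y : Fin s → ℕ+ | (∀ i : I, y i = z i) ∧ ∀ i ∉ I, ((y i : ℕ) : ℝ) ≤ B i}, f y)
          - CMI I z * ∏ i ∈ Iᶜ, B i ^ ϖ i|
        ≤ c * (CE * ‖(fun i : I => ((z i : ℕ) : ℝ))‖ ^ D * (∏ i ∈ Iᶜ, B i ^ ϖ i)
            * (⨅ i : {i : Fin s // i ∉ I}, B i) ^ (-Δ))

/-- The bound `C_{f,M,I}(z) ≤ C_{f,E} ‖z‖ ^ D` for all nonempty proper subsets `I` and all `z`. -/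
def ConstantsBound {s : ℕ} (D CE : ℝ) (CMI : (I : Finset (Fin s)) → (I → ℕ+) → ℝ) : Prop :=
  ∀ I : Finset (Fin s), I.Nonempty → I ≠ Finset.univ → ∀ z : I → ℕ+,
    CMI I z ≤ CE * ‖(fun i : I => ((z i : ℕ) : ℝ))‖ ^ D

/-- The polytope `P^J(y)` in `ℝ^J` obtained by fixing the variables `y i`, `i ∉ J`: its points are
the `t ≥ 0` with `∑ i ∈ J, α i k * (ϖ i)⁻¹ * t i ≤ log (B * ∏ i ∉ J, y i ^ (-α i k)) / log B`. -/
def fiberPolytope {s : ℕ} {κ : Type*} (α : Fin s → κ → ℝ) (ϖ : Fin s → ℝ) (B : ℝ)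
    (J : Finset (Fin s)) (y : {i : Fin s // i ∉ J} → ℕ+) : Set (J → ℝ) :=
  polyhedron (fun i : J => α i) (fun i : J => ϖ i)
    (fun k => Real.log (B * ∏ i : {i : Fin s // i ∉ J}, ((y i : ℕ) : ℝ) ^ (-α i k)) / Real.log B)

/-- The geometric assumption with parameters `N` and `C₁₀`, for all sufficiently large `B`:
whenever `J` is a nonempty proper subset of the indices, `y i ≤ (log B) ^ N` for `i ∉ J`, and the
maximum of `∑ i ∈ J, t i` on `P^J(y)` is at least `a - C₁₀ * log (log B) / log B`, then this maximum
is attained on a face of dimension at most `k - 1`. -/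
def FaceAssumption {s : ℕ} {κ : Type*} (α : Fin s → κ → ℝ) (ϖ : Fin s → ℝ) (N C₁₀ : ℝ) : Prop :=
  ∀ᶠ B : ℝ in Filter.atTop, ∀ J : Finset (Fin s), J.Nonempty → J ≠ Finset.univ →
    ∀ y : {i : Fin s // i ∉ J} → ℕ+, (∀ i, ((y i : ℕ) : ℝ) ≤ Real.log B ^ N) →
      maxValue (polyhedron α ϖ (fun _ => 1)) - C₁₀ * (Real.log (Real.log B) / Real.log B)
          ≤ maxValue (fiberPolytope α ϖ B J y) →
      maxFaceDim (fiberPolytope α ϖ B J y) < maxFaceDim (polyhedron α ϖ (fun _ => 1))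

/-- The range of summation of `S^f`. -/
def region {s : ℕ} {κ : Type*} (α : Fin s → κ → ℝ) (B : ℝ) : Set (Fin s → ℕ+) :=
  {y | ∀ k, ∏ i, ((y i : ℕ) : ℝ) ^ α i k ≤ B}

end

end HyperbolaMethod

open HyperbolaMethod

/-!
The region of summation is described in the logarithmic coordinates `u i = ϖ i * log (y i)`: with
`L = log B`, it consists of the `y` for which `u` lies in the dilate `L • P` of the polytope.
Property I says that the measure which gives mass `f y` to the point `u` has a distribution
function close to that of `CM * exp (∑ i, u i) du` at all points with large coordinates. Two
things remain.

The *main term* is the measure `∫ exp (∑ i, u i) du` over `L • P`, which is integrated along the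
hyperplanes `∑ i, u i = a * L - x`. The slices of `P` at depth `δ` below the maximal face have
volume `cP * δ ^ (s - 1 - k) + O(δ ^ (s - k))` (`exists_volume_asymptotic`): a slice is a
product-like set, of fixed size in the `k` directions of the face and of size `δ` in the others,
and a change of scale by `1 + O(δ)` along the face absorbs the movement of the inactive facets.
Watson's lemma then gives `(s - 1 - k)! * cP * L ^ k * exp (a * L)`, up to a factor `1 + O(1 / L)`
(`exists_expMeasure_asymptotic`).

The *comparison* of the two measures uses a grid of boxes of side length `1 / L`
(`measureReal_polyhedron_compare`). Where all coordinates exceed `A * log L` with `A` large, the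
error of Property I saves any desired power of `L`, and there are only about `L ^ (2 * s)` boxes;
the boxes at the boundary of the polytope are accounted for by changing `L` by `O(1 / L)`
(`exists_shift_bound`). The points with a coordinate below `A * log L` are bounded trivially by
sums of `exp (∑ i, n i)` over integer points `n` of `L • P`. When the small coordinates are fixed,
the remaining ones lie in a polytope with the same facet normals as a fibre `P^J(y)`, and such a
sum is at most `C * L ^ d * exp (L * m)` with `m` the maximum on the fibre and `d` the dimension
of its maximal face, with `C` independent of `y` (`exists_sum_exp_le_of_polytope`): away from the
maximal face the exponential decays at a rate that depends only on the facet normals. If `m` is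
close to the global maximum, the geometric assumption gives `d ≤ k - 1`, which saves a factor `L`;
otherwise the smaller value of `m` saves more. The `O((log L) ^ s)` choices of the small
coordinates account for the power of `log log B` in the error term
(`exists_sum_exp_small_coordinate_le`).

The geometric assumption is used only for indices `y i ≤ (log B) ^ (A / ϖ i)`, where `A` is fixed
before `N`. Hence `C₁₀ > N * s` beats all powers of `log B` that are lost when the small
coordinates are bounded trivially. Sums of `f` over boxes with some short sides are bounded by
Property I as well.
-/

namespace HyperbolaMethod

open MeasureTheory

/-! ### Systems of linear inequalities -/

section Inequalities

variable {E J : Type*} [AddCommGroup E] [Module ℝ E] [Finite J]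

/-- A nonempty polyhedron has a point at which only those inequalities are equalities that are
equalities on the whole polyhedron (a relative interior point). -/
lemma exists_minimal_active (M : J → E →ₗ[ℝ] ℝ) (b : J → ℝ) (h : ∃ x, ∀ j, M j x ≤ b j) :
    ∃ p, (∀ j, M j p ≤ b j) ∧
      ∀ j, M j p = b j → ∀ x, (∀ i, M i x ≤ b i) → M j x = b j := by
  let act : E → Set J := fun p => {j | M j p = b j}
  let S : Set (Set J) := act '' {p | ∀ j, M j p ≤ b j}
  obtain ⟨A, hA⟩ : ∃ A, Minimal (· ∈ S) A :=
    (Set.toFinite S).exists_minimal (by obtain ⟨x, hx⟩ := h; exact ⟨_, x, hx, rfl⟩)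
  obtain ⟨p, hp, hpA⟩ := hA.1
  refine ⟨p, hp, fun j hj x hx => ?_⟩
  -- The active set of the midpoint of `p` and `x` is the intersection of the two active sets.
  have hm : ∀ i, M i ((1 / 2 : ℝ) • p + (1 / 2 : ℝ) • x) = (M i p + M i x) / 2 := by
    intro i; simp only [map_add, map_smul, smul_eq_mul]; ring
  have hq : act ((1 / 2 : ℝ) • p + (1 / 2 : ℝ) • x) ∈ S :=
    ⟨_, fun i => by rw [hm]; linarith [hp i, hx i], rfl⟩
  have hle : act ((1 / 2 : ℝ) • p + (1 / 2 : ℝ) • x) ≤ A := by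
    intro i hi
    have h1 : M i ((1 / 2 : ℝ) • p + (1 / 2 : ℝ) • x) = b i := hi
    rw [hm] at h1
    rw [← hpA]
    change M i p = b i
    linarith [hp i, hx i]
  have hj' : j ∈ act ((1 / 2 : ℝ) • p + (1 / 2 : ℝ) • x) := hA.2 hq hle (hpA ▸ hj)
  have h1 : M j ((1 / 2 : ℝ) • p + (1 / 2 : ℝ) • x) = b j := hj'
  rw [hm] at h1
  linarith

/-- A point of a polyhedron can be moved a little in every direction that is not increasing for
the active inequalities. -/
lemma exists_step (M : J → E →ₗ[ℝ] ℝ) (b : J → ℝ) {p v : E} (hp : ∀ j, M j p ≤ b j)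
    (hv : ∀ j, M j p = b j → M j v ≤ 0) :
    ∃ ε : ℝ, 0 < ε ∧ ∀ j, M j (p + ε • v) ≤ b j := by
  have key : ∀ᶠ ε : ℝ in nhdsWithin 0 (Set.Ioi 0), ∀ j, M j (p + ε • v) ≤ b j := by
    rw [Filter.eventually_all]
    intro j
    simp only [map_add, map_smul, smul_eq_mul]
    rcases (hp j).eq_or_lt with h | h
    · filter_upwards [self_mem_nhdsWithin] with ε hε
      have := mul_nonneg (le_of_lt (Set.mem_Ioi.1 hε)) (neg_nonneg.2 (hv j h))
      linarith
    · have hc : Filter.Tendsto (fun ε : ℝ => M j p + ε * M j v) (nhds 0) (nhds (M j p)) := by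
        have : Continuous fun ε : ℝ => M j p + ε * M j v := by fun_prop
        simpa using this.tendsto 0
      exact ((hc.mono_left nhdsWithin_le_nhds).eventually (gt_mem_nhds h)).mono
        fun ε hε => le_of_lt hε
  obtain ⟨ε, h1, h2⟩ := (key.and self_mem_nhdsWithin).exists
  exact ⟨ε, h2, h1⟩

end Inequalities

/-- If the linear form `σ` is negative on the cone `{v | ∀ j, M j v ≤ 0}` outside the common kernel
of the `M j`, then it decays linearly on this cone. -/
lemma exists_linear_decay {E J : Type*} [AddCommGroup E] [Module ℝ E] [Fintype J]
    (M : J → E →ₗ[ℝ] ℝ) (σ : E →ₗ[ℝ] ℝ)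
    (h : ∀ v, (∀ j, M j v ≤ 0) → σ v ≤ 0 ∧ (σ v = 0 → ∀ j, M j v = 0)) :
    ∃ η : ℝ, 0 < η ∧ ∀ v, (∀ j, M j v ≤ 0) → σ v ≤ -(η * ‖fun j => M j v‖) := by
  let T : E →ₗ[ℝ] (J → ℝ) := LinearMap.pi M
  have hTa : ∀ v j, T v j = M j v := fun v j => rfl
  obtain ⟨φ, hφ⟩ : ∃ φ : Module.Dual ℝ (J → ℝ), T.dualMap φ = σ := by
    have : σ ∈ T.dualMap.range := by
      rw [LinearMap.range_dualMap_eq_dualAnnihilator_ker, Submodule.mem_dualAnnihilator]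
      intro v hv
      have hv' : ∀ j, M j v = 0 := fun j => congrFun hv j
      have h1 := (h v fun j => (hv' j).le).1
      have h2 := (h (-v) fun j => by simp [hv' j]).1
      rw [map_neg] at h2
      linarith
    exact this
  have hφv : ∀ v, φ (T v) = σ v := fun v => by rw [← hφ]; rfl
  have hφc : Continuous φ := φ.continuous_of_finiteDimensional
  let K : Set (J → ℝ) := ((LinearMap.range T : Set (J → ℝ)) ∩ {x | ∀ j, x j ≤ 0}) ∩
    Metric.sphere 0 1
  have hK : IsCompact K := by
    refine (isCompact_sphere _ _).inter_left (IsClosed.inter ?_ ?_)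
    · exact Submodule.closed_of_finiteDimensional _
    · simp only [Set.ofPred_forall]
      exact isClosed_iInter fun j => isClosed_le (continuous_apply j) continuous_const
  obtain ⟨η, hη, hηK⟩ := hK.exists_forall_le' (f := fun x => -φ x) (a := 0)
    hφc.neg.continuousOn (by
      rintro _ ⟨⟨⟨v, rfl⟩, hv⟩, hn⟩
      have hv' : ∀ j, M j v ≤ 0 := hv
      obtain ⟨h1, h2⟩ := h v hv'
      rw [← hφv] at h1 h2
      rcases h1.eq_or_lt with h3 | h3
      · have : T v = 0 := funext (h2 h3)
        rw [this] at hn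
        simp at hn
      · linarith)
  refine ⟨η, hη, fun v hv => ?_⟩
  rw [← hφv]
  change φ (T v) ≤ -(η * ‖T v‖)
  by_cases hz : T v = 0
  · simp [hz]
  have hpos : 0 < ‖T v‖ := norm_pos_iff.2 hz
  have := hηK (‖T v‖⁻¹ • T v) ⟨⟨⟨‖T v‖⁻¹ • v, by simp⟩, fun j => by
    simp only [Pi.smul_apply, smul_eq_mul]
    exact mul_nonpos_of_nonneg_of_nonpos (by positivity) (hv j)⟩, by
    simp [norm_smul, hpos.ne']⟩
  rw [map_smul, smul_eq_mul] at this
  have h3 := mul_le_mul_of_nonneg_left this hpos.le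
  have h4 : ‖T v‖ * -(‖T v‖⁻¹ * φ (T v)) = -φ (T v) := by field_simp
  linarith

/-- A linear subspace of dimension `d` of a coordinate space is parametrized by at most `d` of the
coordinates. -/
lemma exists_separating_coordinates {ι : Type*} [Fintype ι] (V : Submodule ℝ (ι → ℝ)) :
    ∃ K : Finset ι, K.card ≤ Module.finrank ℝ V ∧ ∀ v ∈ V, (∀ i ∈ K, v i = 0) → v = 0 := by
  classical
  let e : ι → Module.Dual ℝ V := fun i => (LinearMap.proj i).comp V.subtype
  obtain ⟨κ, a, ha, hspan, hli⟩ := exists_linearIndependent' ℝ e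
  have : Finite κ := Finite.of_injective a ha
  have := Fintype.ofFinite κ
  refine ⟨Finset.univ.image a, ?_, fun v hv h0 => ?_⟩
  · rw [Finset.card_image_of_injective _ ha, Finset.card_univ, ← Subspace.dual_finrank_eq]
    exact hli.fintype_card_le_finrank
  · let ev : Module.Dual ℝ V →ₗ[ℝ] ℝ := LinearMap.applyₗ (⟨v, hv⟩ : V)
    have hle : Submodule.span ℝ (Set.range e) ≤ LinearMap.ker ev := by
      rw [← hspan, Submodule.span_le]
      rintro _ ⟨k, rfl⟩
      exact h0 (a k) (Finset.mem_image_of_mem _ (Finset.mem_univ _))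
    funext i
    exact hle (Submodule.subset_span ⟨i, rfl⟩)

/-- Exponential sums over integer points are bounded independently of their centre. -/
lemma exists_sum_exp_neg_norm_le {ι : Type*} [Fintype ι] {ε : ℝ} (hε : 0 < ε) :
    ∃ C : ℝ, 0 ≤ C ∧ ∀ (q : ι → ℕ) (T : Finset (ι → ℕ)),
      ∑ n ∈ T, Real.exp (-(ε * ‖fun i => (n i : ℝ) - q i‖)) ≤ C := by
  classical
  set ε' : ℝ := ε / (Fintype.card ι + 1)
  have hε' : 0 < ε' := by positivity
  have hsum : Summable fun m : ℤ => Real.exp (-(ε' * |(m : ℝ)|)) := by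
    have h1 : Summable fun n : ℕ => Real.exp (-(ε' * (n : ℝ))) := by
      have := Real.summable_exp_nat_mul_iff.2 (neg_lt_zero.2 hε')
      refine this.congr fun n => ?_
      ring_nf
    rw [summable_int_iff_summable_nat_and_neg]
    constructor <;> simpa using h1
  set G : ℝ := ∑' m : ℤ, Real.exp (-(ε' * |(m : ℝ)|))
  have hG : 0 ≤ G := tsum_nonneg fun m => (Real.exp_pos _).le
  have h1d : ∀ (c X : ℕ), ∑ n ∈ Finset.range X, Real.exp (-(ε' * |(n : ℝ) - c|)) ≤ G := by
    intro c X
    have hinj : Function.Injective fun n : ℕ => (n : ℤ) - c := fun a b h => by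
      simpa using h
    have := hsum.sum_le_tsum ((Finset.range X).image fun n : ℕ => (n : ℤ) - c)
      (fun _ _ => (Real.exp_pos _).le)
    rw [Finset.sum_image hinj.injOn] at this
    simpa using this
  refine ⟨G ^ Fintype.card ι, by positivity, fun q T => ?_⟩
  obtain ⟨X, hX⟩ : ∃ X, T ⊆ Fintype.piFinset fun _ : ι => Finset.range X := by
    refine ⟨T.sup (fun n => ∑ i, n i) + 1, fun n hn => ?_⟩
    simp only [Fintype.mem_piFinset, Finset.mem_range]
    intro i
    have h1 : n i ≤ ∑ i, n i := Finset.single_le_sum (fun _ _ => Nat.zero_le _) (Finset.mem_univ i)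
    have h2 : ∑ i, n i ≤ T.sup (fun n => ∑ i, n i) := Finset.le_sup (f := fun n => ∑ i, n i) hn
    omega
  calc ∑ n ∈ T, Real.exp (-(ε * ‖fun i => (n i : ℝ) - q i‖))
      ≤ ∑ n ∈ T, ∏ i, Real.exp (-(ε' * |(n i : ℝ) - q i|)) := by
        refine Finset.sum_le_sum fun n _ => ?_
        rw [← Real.exp_sum, Real.exp_le_exp, Finset.sum_neg_distrib, neg_le_neg_iff,
          ← Finset.mul_sum]
        set N := ‖fun i => (n i : ℝ) - q i‖
        have h1 : ∑ i, |(n i : ℝ) - q i| ≤ Fintype.card ι * N := by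
          have : ∀ i ∈ Finset.univ, |(n i : ℝ) - q i| ≤ N := fun i _ => by
            have := norm_le_pi_norm (fun i => (n i : ℝ) - q i) i
            simpa using this
          simpa using Finset.sum_le_card_nsmul _ _ _ this
        have h2 : ε' * (Fintype.card ι + 1) = ε := by simp only [ε']; field_simp
        have hN : 0 ≤ N := norm_nonneg _
        nlinarith [mul_le_mul_of_nonneg_left h1 hε'.le, mul_nonneg hε'.le hN]
    _ ≤ ∑ n ∈ Fintype.piFinset fun _ : ι => Finset.range X,
          ∏ i, Real.exp (-(ε' * |(n i : ℝ) - q i|)) :=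
        Finset.sum_le_sum_of_subset_of_nonneg hX fun _ _ _ =>
          Finset.prod_nonneg fun _ _ => (Real.exp_pos _).le
    _ = ∏ i, ∑ m ∈ Finset.range X, Real.exp (-(ε' * |(m : ℝ) - q i|)) :=
        (Finset.prod_univ_sum (fun _ => Finset.range X)
          fun i m => Real.exp (-(ε' * |(m : ℝ) - q i|))).symm
    _ ≤ ∏ _i : ι, G := Finset.prod_le_prod (fun _ _ => Finset.sum_nonneg fun _ _ =>
        (Real.exp_pos _).le) fun i _ => h1d _ _
    _ = G ^ Fintype.card ι := by simp

/-! ### Exponential sums over the integer points of a polytope -/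

/-- Integer points of a box, weighted by the exponential of the linear form `∑ i, t i`, in a cone
with apex `p` on which this form is maximal exactly along the lineality space: the sum is governed
by the value at `p` and by the dimension of the lineality space. -/
lemma exists_sum_exp_le_of_cone {ι J : Type*} [Fintype ι] [Fintype J]
    (M : J → (ι → ℝ) →ₗ[ℝ] ℝ) {R₀ : ℝ} (hR₀ : 0 ≤ R₀)
    (h : ∀ v : ι → ℝ, (∀ j, M j v ≤ 0) → ∑ i, v i ≤ 0 ∧ (∑ i, v i = 0 → ∀ j, M j v = 0)) :
    ∃ C : ℝ, 0 ≤ C ∧ ∀ (p : ι → ℝ) (L : ℝ), 1 ≤ L → ∀ T : Finset (ι → ℕ),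
      (∀ n ∈ T, (∀ i, (n i : ℝ) ≤ R₀ * L) ∧ ∀ j, M j (fun i => (n i : ℝ)) ≤ L * M j p) →
      ∑ n ∈ T, Real.exp (∑ i, (n i : ℝ)) ≤
        C * L ^ Module.finrank ℝ (⨅ j, LinearMap.ker (M j) : Submodule ℝ (ι → ℝ)) *
          Real.exp (L * ∑ i, p i) := by
  classical
  set V : Submodule ℝ (ι → ℝ) := ⨅ j, LinearMap.ker (M j)
  let σ : (ι → ℝ) →ₗ[ℝ] ℝ := ∑ i, LinearMap.proj i
  have hσ : ∀ v, σ v = ∑ i, v i := fun v => by simp [σ]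
  obtain ⟨η, hη, hdecay⟩ := exists_linear_decay M σ (by simpa only [hσ] using h)
  obtain ⟨K, hKcard, hK⟩ := exists_separating_coordinates V
  let T' : (ι → ℝ) →ₗ[ℝ] (J → ℝ) := LinearMap.pi M
  -- On the vectors whose coordinates in `K` vanish the forms `M j` control the norm.
  let W : Submodule ℝ (ι → ℝ) := ⨅ i : K, LinearMap.ker (LinearMap.proj (i : ι))
  obtain ⟨c, hc, hanti⟩ := (T'.comp W.subtype).exists_antilipschitzWith (by
    rw [LinearMap.ker_eq_bot']
    rintro ⟨w, hw⟩ h0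
    have h1 : ∀ j, M j w = 0 := fun j => congrFun h0 j
    have h2 : ∀ i ∈ K, w i = 0 := fun i hi => by
      have := (Submodule.mem_iInf _).1 hw ⟨i, hi⟩
      simpa using this
    exact Subtype.ext (hK w ((Submodule.mem_iInf _).2 h1) h2))
  have hnorm : ∀ v : ι → ℝ, (∀ i ∈ K, v i = 0) → ‖v‖ ≤ c * ‖T' v‖ := by
    intro v hv
    have hvW : v ∈ W := (Submodule.mem_iInf _).2 fun i => hv i i.2
    have := hanti.le_mul_dist ⟨v, hvW⟩ 0
    simpa using this
  have hc' : (0 : ℝ) < c := by exact_mod_cast hc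
  set ε : ℝ := η / (2 * c)
  have hε : 0 < ε := by positivity
  obtain ⟨C, hC, hCsum⟩ := exists_sum_exp_neg_norm_le (ι := ι) hε
  refine ⟨(R₀ + 1) ^ K.card * C, by positivity, fun p L hL T hT => ?_⟩
  have hpow : L ^ K.card ≤ L ^ Module.finrank ℝ V := pow_le_pow_right₀ hL hKcard
  let x : (ι → ℕ) → ι → ℝ := fun n i => (n i : ℝ) - L * p i
  let r : (ι → ℕ) → K → ℕ := fun n i => n i
  let Y : Finset (K → ℕ) := Fintype.piFinset fun _ => Finset.range (⌊R₀ * L⌋₊ + 1)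
  have hmaps : ∀ n ∈ T, r n ∈ Y := by
    intro n hn
    simp only [Y, r, Fintype.mem_piFinset, Finset.mem_range]
    intro i
    have := Nat.le_floor ((hT n hn).1 i)
    omega
  have hY : (Y.card : ℝ) ≤ (R₀ + 1) ^ K.card * L ^ K.card := by
    have h1 : Y.card = (⌊R₀ * L⌋₊ + 1) ^ K.card := by simp [Y]
    rw [h1, ← mul_pow]
    push_cast
    have := Nat.floor_le (show 0 ≤ R₀ * L by positivity)
    gcongr
    nlinarith
  have hterm : ∀ n ∈ T, ∑ i, (n i : ℝ) ≤ L * ∑ i, p i - η * ‖T' (x n)‖ := by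
    intro n hn
    have hx : x n = (fun i => (n i : ℝ)) - L • p := by
      ext i; simp [x]
    have h1 := hdecay (x n) (fun j => by
      rw [hx, map_sub, map_smul, smul_eq_mul]; linarith [(hT n hn).2 j])
    have h2 : σ (x n) = ∑ i, (n i : ℝ) - L * ∑ i, p i := by
      rw [hσ, Finset.mul_sum, ← Finset.sum_sub_distrib]
    rw [h2] at h1
    change _ ≤ -(η * ‖T' (x n)‖) at h1
    linarith
  have hfib : ∀ y ∈ Y, ∑ n ∈ T with r n = y, Real.exp (∑ i, (n i : ℝ)) ≤
      C * Real.exp (L * ∑ i, p i) := by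
    intro y _
    rcases (T.filter fun n => r n = y).eq_empty_or_nonempty with h0 | hne
    · rw [h0]; simp only [Finset.sum_empty]; positivity
    obtain ⟨q, hq, hqmin⟩ := Finset.exists_min_image _ (fun n => ‖T' (x n)‖) hne
    calc ∑ n ∈ T with r n = y, Real.exp (∑ i, (n i : ℝ))
        ≤ ∑ n ∈ T with r n = y, Real.exp (-(ε * ‖fun i => (n i : ℝ) - q i‖)) *
            Real.exp (L * ∑ i, p i) := by
          refine Finset.sum_le_sum fun n hn => ?_
          rw [← Real.exp_add, Real.exp_le_exp]
          have h1 := hterm n (Finset.mem_filter.1 hn).1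
          have h2 : ‖fun i => (n i : ℝ) - q i‖ ≤ c * ‖T' (fun i => (n i : ℝ) - q i)‖ := by
            refine hnorm _ fun i hi => ?_
            have h3 : r n = r q := (Finset.mem_filter.1 hn).2.trans (Finset.mem_filter.1 hq).2.symm
            have h4 : n i = q i := congrFun h3 ⟨i, hi⟩
            simp [h4]
          have h5 : T' (fun i => (n i : ℝ) - q i) = T' (x n) - T' (x q) := by
            rw [← map_sub]; congr 1; ext i; simp [x]
          have h6 : ‖T' (x n) - T' (x q)‖ ≤ 2 * ‖T' (x n)‖ := by
            have := norm_sub_le (T' (x n)) (T' (x q))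
            have := hqmin n hn
            linarith
          rw [h5] at h2
          have h7 : ‖fun i => (n i : ℝ) - q i‖ ≤ c * (2 * ‖T' (x n)‖) :=
            h2.trans (by gcongr)
          have h8 : ε * ‖fun i => (n i : ℝ) - q i‖ ≤ η * ‖T' (x n)‖ := by
            calc _ ≤ ε * (c * (2 * ‖T' (x n)‖)) := by gcongr
              _ = η * ‖T' (x n)‖ := by simp only [ε]; field_simp
          linarith
      _ ≤ C * Real.exp (L * ∑ i, p i) := by
          rw [← Finset.sum_mul]
          gcongr
          exact hCsum q _
  calc ∑ n ∈ T, Real.exp (∑ i, (n i : ℝ))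
      = ∑ y ∈ Y, ∑ n ∈ T with r n = y, Real.exp (∑ i, (n i : ℝ)) :=
        (Finset.sum_fiberwise_of_maps_to hmaps _).symm
    _ ≤ Y.card • (C * Real.exp (L * ∑ i, p i)) := Finset.sum_le_card_nsmul _ _ _ hfib
    _ ≤ ((R₀ + 1) ^ K.card * L ^ Module.finrank ℝ V) * (C * Real.exp (L * ∑ i, p i)) := by
        rw [nsmul_eq_mul]
        gcongr
        exact hY.trans (by gcongr)
    _ = _ := by ring

lemma exists_isMaxOn_of_isCompact {ι : Type*} [Fintype ι] {G : Set (ι → ℝ)} (hG : IsCompact G)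
    (hne : G.Nonempty) : ∃ x ∈ G, ∑ i, x i = maxValue G ∧ ∀ y ∈ G, ∑ i, y i ≤ maxValue G := by
  have hc : Continuous fun t : ι → ℝ => ∑ i, t i := by fun_prop
  obtain ⟨x, hx, hxe, hmax⟩ := hG.exists_sSup_image_eq_and_ge hne hc.continuousOn
  exact ⟨x, hx, hxe.symm, fun y hy => (hmax y hy).trans_eq hxe.symm⟩

/-- The sum of `exp (∑ i, n i)` over the integer points of the `L`-fold dilate of a polytope is at
most `C * L ^ d * exp (L * a)`, where `a` is the maximum of `∑ i, t i` on the polytope and `d` is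
the dimension of the face where it is attained. The constant depends only on the normal vectors of the
polytope and on the size of a box that contains it. -/
lemma exists_sum_exp_le_of_polytope {ι J : Type*} [Fintype ι] [Fintype J]
    (M : J → (ι → ℝ) →ₗ[ℝ] ℝ) {R₀ : ℝ} (hR₀ : 0 ≤ R₀) :
    ∃ C : ℝ, 0 ≤ C ∧ ∀ (b : J → ℝ) (G : Set (ι → ℝ)), G = {x | ∀ j, M j x ≤ b j} →
      (∀ x ∈ G, ∀ i, 0 ≤ x i ∧ x i ≤ R₀) → ∀ L : ℝ, 1 ≤ L → ∀ T : Finset (ι → ℕ),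
      (∀ n ∈ T, (fun i => (n i : ℝ) / L) ∈ G) →
      ∑ n ∈ T, Real.exp (∑ i, (n i : ℝ)) ≤
        C * L ^ maxFaceDim G * Real.exp (L * maxValue G) := by
  classical
  have hS : ∀ S : Finset J, ∃ C : ℝ, 0 ≤ C ∧
      ((∀ v : ι → ℝ, (∀ j ∈ S, M j v ≤ 0) →
          ∑ i, v i ≤ 0 ∧ (∑ i, v i = 0 → ∀ j ∈ S, M j v = 0)) →
        ∀ (p : ι → ℝ) (L : ℝ), 1 ≤ L → ∀ T : Finset (ι → ℕ),
          (∀ n ∈ T, (∀ i, (n i : ℝ) ≤ R₀ * L) ∧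
            ∀ j ∈ S, M j (fun i => (n i : ℝ)) ≤ L * M j p) →
          ∑ n ∈ T, Real.exp (∑ i, (n i : ℝ)) ≤
            C * L ^ Module.finrank ℝ (⨅ j : S, LinearMap.ker (M j) : Submodule ℝ (ι → ℝ)) *
              Real.exp (L * ∑ i, p i)) := by
    intro S
    by_cases h : ∀ v : ι → ℝ, (∀ j ∈ S, M j v ≤ 0) →
          ∑ i, v i ≤ 0 ∧ (∑ i, v i = 0 → ∀ j ∈ S, M j v = 0)
    · obtain ⟨C, hC, hCs⟩ := exists_sum_exp_le_of_cone (fun j : S => M j) hR₀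
        (by simpa only [Subtype.forall] using h)
      refine ⟨C, hC, fun _ => ?_⟩
      simpa only [Subtype.forall] using hCs
    · exact ⟨0, le_rfl, fun h' => absurd h' h⟩
  choose C hC hCS using hS
  refine ⟨∑ S, C S, Finset.sum_nonneg fun S _ => hC S, ?_⟩
  intro b G hG hbox L hL T hT
  rcases T.eq_empty_or_nonempty with rfl | ⟨n₀, hn₀⟩
  · simp only [Finset.sum_empty]
    have := Finset.sum_nonneg fun S (_ : S ∈ Finset.univ) => hC S
    positivity
  have hL0 : 0 < L := by linarith
  have hclosed : IsClosed G := by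
    rw [hG]
    simp only [Set.ofPred_forall]
    exact isClosed_iInter fun j =>
      isClosed_le (M j).continuous_of_finiteDimensional continuous_const
  have hcomp : IsCompact G :=
    (isCompact_univ_pi fun _ : ι => isCompact_Icc (a := 0) (b := R₀)).of_isClosed_subset
      hclosed fun x hx i _ => hbox x hx i
  obtain ⟨x₀, hx₀, hx₀a, hmax⟩ := exists_isMaxOn_of_isCompact hcomp ⟨_, hT n₀ hn₀⟩
  set a := maxValue G
  let σ : (ι → ℝ) →ₗ[ℝ] ℝ := ∑ i, LinearMap.proj i
  have hσ : ∀ v, σ v = ∑ i, v i := fun v => by simp [σ]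
  have hmem : ∀ x, x ∈ G ↔ ∀ j, M j x ≤ b j := fun x => by rw [hG]; rfl
  -- The maximal face is cut out by the additional inequality `-∑ i, t i ≤ -a`.
  let M' : Option J → (ι → ℝ) →ₗ[ℝ] ℝ := fun o => o.elim (-σ) M
  let b' : Option J → ℝ := fun o => o.elim (-a) b
  have hface : ∀ x, (∀ o, M' o x ≤ b' o) ↔ x ∈ maxFace G := by
    intro x
    rw [Option.forall]
    simp only [M', b', Option.elim_none, Option.elim_some, LinearMap.neg_apply, hσ]
    constructor
    · rintro ⟨h1, h2⟩
      exact ⟨(hmem x).2 h2, le_antisymm (hmax x ((hmem x).2 h2)) (by linarith)⟩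
    · rintro ⟨h1, h2⟩
      exact ⟨by rw [h2], (hmem x).1 h1⟩
  obtain ⟨p, hp, hact⟩ := exists_minimal_active M' b' ⟨x₀, (hface x₀).2 ⟨hx₀, hx₀a⟩⟩
  have hpF := (hface p).1 hp
  have hpG := (hmem p).1 hpF.1
  let S : Finset J := Finset.univ.filter fun j => M j p = b j
  have hcone : ∀ v : ι → ℝ, (∀ j ∈ S, M j v ≤ 0) → ∑ i, v i ≤ 0 ∧
      (∑ i, v i = 0 → (∀ j ∈ S, M j v = 0) ∧ v ∈ vectorSpan ℝ (maxFace G)) := by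
    intro v hv
    obtain ⟨ε, hε, hstep⟩ := exists_step M b hpG (v := v) fun j hj => hv j (by simp [S, hj])
    have hstepG := (hmem _).2 hstep
    have hsum : ∑ i, (p + ε • v) i = a + ε * ∑ i, v i := by
      rw [← hσ, map_add, map_smul, hσ, hσ, hpF.2, smul_eq_mul]
    have h1 := hmax _ hstepG
    rw [hsum] at h1
    refine ⟨by nlinarith, fun h0 => ?_⟩
    have h2 : p + ε • v ∈ maxFace G := ⟨hstepG, by rw [hsum, h0]; simp [a]⟩
    refine ⟨fun j hj => ?_, ?_⟩
    · have hj' : M' (some j) p = b' (some j) := (Finset.mem_filter.1 hj).2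
      have h3 := hact (some j) hj' _ ((hface _).2 h2)
      rw [map_add, map_smul, hj', smul_eq_mul] at h3
      have h4 : ε * M j v = 0 := by
        have : ε * M' (some j) v = 0 := by linarith
        exact this
      exact (mul_eq_zero.1 h4).resolve_left hε.ne'
    · have h3 := vsub_mem_vectorSpan ℝ h2 hpF
      have h4 : (p + ε • v) -ᵥ p = ε • v := by simp
      rw [h4] at h3
      have := Submodule.smul_mem _ ε⁻¹ h3
      rwa [smul_smul, inv_mul_cancel₀ hε.ne', one_smul] at this
  have hdim : Module.finrank ℝ (⨅ j : S, LinearMap.ker (M j) : Submodule ℝ (ι → ℝ)) ≤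
      maxFaceDim G := by
    refine Submodule.finrank_mono fun v hv => ?_
    have hv0 : ∀ j ∈ S, M j v = 0 := fun j hj => (Submodule.mem_iInf _).1 hv ⟨j, hj⟩
    have h1 := hcone v fun j hj => (hv0 j hj).le
    have h2 := (hcone (-v) fun j hj => by simp [hv0 j hj]).1
    refine (h1.2 (le_antisymm h1.1 ?_)).2
    simp only [Pi.neg_apply, Finset.sum_neg_distrib] at h2
    linarith
  have hmain := hCS S (fun v hv => ⟨(hcone v hv).1, fun h0 => ((hcone v hv).2 h0).1⟩) p L hL T
    (by
      intro n hn
      have hnG := hT n hn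
      refine ⟨fun i => ?_, fun j hj => ?_⟩
      · have := (hbox _ hnG i).2
        rwa [div_le_iff₀ hL0] at this
      · have h1 := (hmem _).1 hnG j
        have h2 : (fun i => (n i : ℝ)) = L • fun i => (n i : ℝ) / L := by
          ext i; simp only [Pi.smul_apply, smul_eq_mul]; field_simp
        rw [(Finset.mem_filter.1 hj).2, h2, map_smul, smul_eq_mul]
        gcongr)
  rw [hpF.2] at hmain
  refine hmain.trans ?_
  have h1 : C S ≤ ∑ S, C S := Finset.single_le_sum (fun S _ => hC S) (Finset.mem_univ S)
  gcongr
  exact (hC S).trans h1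

/-! ### Volumes of polytopes shrinking to a face -/

/-- The determinant of the map that is `r` on `V` and `δ` on a complement `W`. -/
lemma det_smul_projection_add_smul_projection {E : Type*} [AddCommGroup E] [Module ℝ E]
    [FiniteDimensional ℝ E] {V W : Submodule ℝ E} (h : IsCompl V W) (r δ : ℝ) :
    LinearMap.det (r • V.projection W h + δ • W.projection V h.symm) =
      r ^ Module.finrank ℝ V * δ ^ Module.finrank ℝ W := by
  set e := Submodule.prodEquivOfIsCompl V W h
  have key : r • V.projection W h + δ • W.projection V h.symm =
      (e : (V × W) →ₗ[ℝ] E) ∘ₗ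
        (LinearMap.prodMap (r • LinearMap.id) (δ • LinearMap.id)) ∘ₗ (e.symm : E →ₗ[ℝ] V × W) := by
    refine LinearMap.ext fun x => ?_
    obtain ⟨⟨v, w⟩, rfl⟩ := e.surjective x
    simp [e, Submodule.coe_prodEquivOfIsCompl']
  rw [key, LinearMap.det_conj, LinearMap.det_prodMap]
  simp

lemma one_add_pow_le (d : ℕ) {x : ℝ} (h0 : 0 ≤ x) (h1 : x ≤ 1) :
    (1 + x) ^ d ≤ 1 + 3 ^ d * x := by
  induction d with
  | zero => simpa using h0
  | succ d ih =>
    have h3 : (1 : ℝ) ≤ 3 ^ d := one_le_pow₀ (by norm_num)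
    calc (1 + x) ^ (d + 1) = (1 + x) ^ d * (1 + x) := pow_succ _ _
      _ ≤ (1 + 3 ^ d * x) * (1 + x) := by gcongr
      _ ≤ 1 + 3 ^ (d + 1) * x := by
        rw [pow_succ]
        nlinarith [mul_nonneg (mul_nonneg (by positivity : (0 : ℝ) ≤ 3 ^ d) h0) (sub_nonneg.2 h1),
          mul_nonneg h0 (sub_nonneg.2 h3)]

/-- Volume of a polytope whose right-hand sides move linearly, near a parameter value where it
degenerates to a polytope of smaller dimension `d`. -/
theorem exists_volume_asymptotic {ι J : Type*} [Fintype ι] [Finite J]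
    (M : J → (ι → ℝ) →ₗ[ℝ] ℝ) (b e : J → ℝ) (hne : {x | ∀ j, M j x ≤ b j}.Nonempty)
    (hbd : Bornology.IsBounded {x | ∀ j, M j x ≤ b j}) :
    ∃ c C δ₀ : ℝ, 0 ≤ C ∧ 0 < δ₀ ∧ ∀ δ : ℝ, 0 < δ → δ < δ₀ →
      |volume.real {x | ∀ j, M j x ≤ b j + δ * e j} -
          c * δ ^ (Fintype.card ι - Module.finrank ℝ (vectorSpan ℝ {x | ∀ j, M j x ≤ b j}))| ≤
        C * δ ^ (Fintype.card ι -
          Module.finrank ℝ (vectorSpan ℝ {x | ∀ j, M j x ≤ b j}) + 1) := by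
  classical
  have := Fintype.ofFinite J
  set G : Set (ι → ℝ) := {x | ∀ j, M j x ≤ b j} with hG
  obtain ⟨p, hp, hact⟩ := exists_minimal_active M b hne
  set V := vectorSpan ℝ G
  set S : Finset J := Finset.univ.filter fun j => M j p = b j
  have hS : ∀ j, j ∈ S ↔ M j p = b j := fun j => by simp [S]
  have hV0 : ∀ v ∈ V, ∀ j ∈ S, M j v = 0 := by
    intro v hv j hj
    have hle : V ≤ LinearMap.ker (M j) := by
      refine Submodule.span_le.2 ?_
      rintro _ ⟨x, hx, y, hy, rfl⟩
      have h1 := hact j ((hS j).1 hj) x hx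
      have h2 := hact j ((hS j).1 hj) y hy
      simp [h1, h2]
    exact hle hv
  have hVmem : ∀ v, p + v ∈ G → v ∈ V := by
    intro v hv
    have := vsub_mem_vectorSpan ℝ hv (show p ∈ G from hp)
    simpa using this
  obtain ⟨W, hVW⟩ := Submodule.exists_isCompl V
  set πV := V.projection W hVW
  set πW := W.projection V hVW.symm
  have hπ : ∀ z, πV z + πW z = z := fun z => Submodule.projection_add_projection_eq_self hVW z
  have hπV : ∀ z, πV z ∈ V := fun z => by simp [πV]
  have hπW : ∀ z, πW z ∈ W := fun z => by simp [πW]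
  -- The cross-section of the cone of the active inequalities is bounded.
  obtain ⟨η, hη, hηW⟩ : ∃ η : ℝ, 0 < η ∧ ∀ w ∈ W, η * ‖w‖ ≤ ∑ j ∈ S, max (M j w) 0 := by
    have hcont : Continuous fun w : ι → ℝ => ∑ j ∈ S, max (M j w) 0 :=
      continuous_finsetSum _ fun j _ =>
        ((M j).continuous_of_finiteDimensional).max continuous_const
    have hK : IsCompact ((W : Set (ι → ℝ)) ∩ Metric.sphere 0 1) :=
      (isCompact_sphere _ _).inter_left (Submodule.closed_of_finiteDimensional _)
    obtain ⟨η, hη, h⟩ := hK.exists_forall_le' (a := 0) hcont.continuousOn (by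
      rintro w ⟨hw, hw1⟩
      by_contra hcon
      have h0 : ∀ j ∈ S, M j w ≤ 0 := by
        intro j hj
        have h1 := Finset.single_le_sum (f := fun j => max (M j w) 0)
          (fun j _ => le_max_right _ _) hj
        exact (le_max_left _ _).trans (h1.trans (not_lt.1 hcon))
      obtain ⟨ε, hε, hstep⟩ := exists_step M b hp (v := w) fun j hj => h0 j ((hS j).2 hj)
      have h1 := Submodule.smul_mem _ ε⁻¹ (hVmem _ hstep)
      rw [smul_smul, inv_mul_cancel₀ hε.ne', one_smul] at h1
      have h2 : w = 0 := (Submodule.disjoint_def.1 hVW.disjoint) w h1 hw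
      rw [h2] at hw1
      simp at hw1)
    refine ⟨η, hη, fun w hw => ?_⟩
    by_cases hz : w = 0
    · simp [hz]
    have hpos : 0 < ‖w‖ := norm_pos_iff.2 hz
    have h1 := h (‖w‖⁻¹ • w) ⟨W.smul_mem _ hw, by simp [norm_smul, hpos.ne']⟩
    have h2 : ∀ j, max (M j (‖w‖⁻¹ • w)) 0 = ‖w‖⁻¹ * max (M j w) 0 := by
      intro j
      rw [map_smul, smul_eq_mul, mul_max_of_nonneg _ _ (by positivity : 0 ≤ ‖w‖⁻¹), mul_zero]
    simp only [h2] at h1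
    rw [← Finset.mul_sum, inv_mul_eq_div, le_div_iff₀ hpos] at h1
    exact h1
  set G' : Set (ι → ℝ) := {z | (∀ j ∈ S, M j (πW z) ≤ e j) ∧
    ∀ j ∉ S, M j (πV z) ≤ b j - M j p} with hG'
  obtain ⟨R, hR⟩ : ∃ R : ℝ, ∀ w ∈ W, (∀ j ∈ S, M j w ≤ e j) → ‖w‖ ≤ R := by
    refine ⟨(∑ j ∈ S, max (e j) 0) / η, fun w hw h => ?_⟩
    rw [le_div_iff₀ hη, mul_comm]
    exact (hηW w hw).trans (Finset.sum_le_sum fun j hj => max_le_max (h j hj) le_rfl)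
  have hG'bd : Bornology.IsBounded G' := by
    obtain ⟨R', hR'⟩ := hbd.exists_norm_le
    refine isBounded_iff_forall_norm_le.2 ⟨R' + ‖p‖ + R, fun z hz => ?_⟩
    have h1 := hR _ (hπW z) hz.1
    have h2 : p + πV z ∈ G := by
      intro j
      rw [map_add]
      by_cases hj : j ∈ S
      · rw [hV0 _ (hπV z) j hj, (hS j).1 hj, add_zero]
      · linarith [hz.2 j hj]
    have h3 := hR' _ h2
    have h4 : ‖πV z‖ ≤ ‖p + πV z‖ + ‖p‖ := by
      have := norm_sub_le (p + πV z) p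
      simpa using this
    rw [← hπ z]
    exact (norm_add_le _ _).trans (by linarith)
  have hG'fin : volume G' ≠ ⊤ := hG'bd.measure_lt_top.ne
  -- A change of scale on `V` absorbs the movement of the inactive inequalities.
  obtain ⟨C₁, hC₁, hC₁'⟩ : ∃ C₁ : ℝ, 0 < C₁ ∧ ∀ j ∉ S, ∀ w ∈ W, (∀ j ∈ S, M j w ≤ e j) →
      |e j - M j w| ≤ C₁ * (b j - M j p) := by
    have hj : ∀ j, ∃ C₁ : ℝ, 0 ≤ C₁ ∧ (j ∉ S → ∀ w ∈ W, (∀ j ∈ S, M j w ≤ e j) →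
        |e j - M j w| ≤ C₁ * (b j - M j p)) := by
      intro j
      by_cases hjS : j ∈ S
      · exact ⟨0, le_rfl, fun h => absurd hjS h⟩
      have hβ : 0 < b j - M j p := by
        rw [hS] at hjS
        exact sub_pos.2 (lt_of_le_of_ne (hp j) hjS)
      set A := LinearMap.toContinuousLinearMap (M j)
      refine ⟨(|e j| + ‖A‖ * |R|) / (b j - M j p), by positivity, fun _ w hw h => ?_⟩
      rw [div_mul_cancel₀ _ hβ.ne']
      have h1 : |M j w| ≤ ‖A‖ * ‖w‖ := A.le_opNorm w
      have h2 : ‖A‖ * ‖w‖ ≤ ‖A‖ * |R| :=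
        mul_le_mul_of_nonneg_left ((hR w hw h).trans (le_abs_self R)) (norm_nonneg A)
      exact (abs_sub _ _).trans (by linarith)
    choose C₁ hC₁ hC₁' using hj
    refine ⟨∑ j, C₁ j + 1, by have := Finset.sum_nonneg fun j (_ : j ∈ Finset.univ) => hC₁ j
                              positivity, fun j hj w hw h => (hC₁' j hj w hw h).trans ?_⟩
    have h1 := Finset.single_le_sum (fun j _ => hC₁ j) (Finset.mem_univ j)
    have h2 : 0 ≤ b j - M j p := sub_nonneg.2 (hp j)
    gcongr
    linarith
  let T : ℝ → ℝ → (ι → ℝ) →ₗ[ℝ] (ι → ℝ) := fun r δ => r • πV + δ • πW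
  have hTV : ∀ r δ z, πV (T r δ z) = r • πV z := by
    intro r δ z
    have h1 : πV (πV z) = πV z := by simp [πV]
    have h2 : πV (πW z) = 0 := by simp [πV, πW]
    simp only [T, LinearMap.add_apply, LinearMap.smul_apply, map_add, map_smul, h1, h2]
    simp
  have hTW : ∀ r δ z, πW (T r δ z) = δ • πW z := by
    intro r δ z
    have h1 : πW (πW z) = πW z := by simp [πW]
    have h2 : πW (πV z) = 0 := by simp [πV, πW]
    simp only [T, LinearMap.add_apply, LinearMap.smul_apply, map_add, map_smul, h1, h2]
    simp
  have hMp : ∀ j z, M j (p + z) = M j p + (M j (πV z) + M j (πW z)) := fun j z => by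
    rw [map_add]; congr 1; rw [← map_add, hπ]
  have hdimW : Module.finrank ℝ W = Fintype.card ι - Module.finrank ℝ V := by
    have := Submodule.finrank_add_eq_of_isCompl hVW
    rw [Module.finrank_fintype_fun_eq_card] at this
    omega
  have hvolT : ∀ r δ : ℝ, 0 ≤ r → 0 ≤ δ → volume.real (T r δ '' G') =
      r ^ Module.finrank ℝ V * δ ^ (Fintype.card ι - Module.finrank ℝ V) * volume.real G' := by
    intro r δ hr hδ
    rw [Measure.real, Measure.addHaar_image_linearMap,
      det_smul_projection_add_smul_projection, ENNReal.toReal_mul, hdimW,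
      abs_of_nonneg (by positivity), ENNReal.toReal_ofReal (by positivity), Measure.real]
  have hfinT : ∀ r δ : ℝ, volume (T r δ '' G') ≠ ⊤ := by
    intro r δ
    rw [Measure.addHaar_image_linearMap]
    exact ENNReal.mul_ne_top ENNReal.ofReal_ne_top hG'fin
  set m := Fintype.card ι - Module.finrank ℝ V
  set d := Module.finrank ℝ V
  set c := volume.real G'
  have hc : 0 ≤ c := measureReal_nonneg
  refine ⟨c, 3 ^ d * C₁ * c, 1 / C₁, by positivity, by positivity, fun δ hδ hδ₁ => ?_⟩
  rw [lt_div_iff₀ hC₁, mul_comm] at hδ₁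
  have hx : 0 < C₁ * δ := by positivity
  set Gδ : Set (ι → ℝ) := {x | ∀ j, M j x ≤ b j + δ * e j}
  have hvol : volume.real ((fun z => p + z) ⁻¹' Gδ) = volume.real Gδ := by
    rw [Measure.real, measure_preimage_add, Measure.real]
  have hsub1 : (fun z => p + z) ⁻¹' Gδ ⊆ T (1 + C₁ * δ) δ '' G' := by
    intro z hz
    have hz' : ∀ j, M j p + (M j (πV z) + M j (πW z)) ≤ b j + δ * e j := fun j => by
      rw [← hMp]; exact hz j
    have hWS : ∀ j ∈ S, M j (πW (δ⁻¹ • z)) ≤ e j := by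
      intro j hj
      have := hz' j
      rw [hV0 _ (hπV z) j hj, (hS j).1 hj] at this
      rw [map_smul, map_smul, smul_eq_mul, inv_mul_le_iff₀ hδ]
      linarith
    have hr : (1 + C₁ * δ) ≠ 0 := by positivity
    refine ⟨T (1 + C₁ * δ)⁻¹ δ⁻¹ z, ⟨fun j hj => ?_, fun j hj => ?_⟩, ?_⟩
    · rw [hTW, ← map_smul]; exact hWS j hj
    · rw [hTV, map_smul, smul_eq_mul, inv_mul_le_iff₀ (by positivity)]
      have h1 := hC₁' j hj _ (hπW _) hWS
      have h2 := hz' j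
      rw [map_smul, map_smul, smul_eq_mul] at h1
      have h3 := mul_le_mul_of_nonneg_left ((neg_le_abs _).trans h1) hδ.le
      have h4 := mul_le_mul_of_nonneg_left ((le_abs_self _).trans h1) hδ.le
      have h5 : δ * (δ⁻¹ * M j (πW z)) = M j (πW z) := by field_simp
      nlinarith
    · rw [← hπ (T (1 + C₁ * δ) δ (T (1 + C₁ * δ)⁻¹ δ⁻¹ z)), hTV, hTW, hTV, hTW, smul_smul,
        smul_smul, mul_inv_cancel₀ hr, mul_inv_cancel₀ hδ.ne', one_smul, one_smul, hπ]
  have hsub2 : T (1 - C₁ * δ) δ '' G' ⊆ (fun z => p + z) ⁻¹' Gδ := by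
    rintro _ ⟨z, hz, rfl⟩ j
    rw [hMp, hTV, hTW, map_smul, map_smul, smul_eq_mul, smul_eq_mul]
    by_cases hj : j ∈ S
    · rw [hV0 _ (hπV z) j hj, (hS j).1 hj]
      nlinarith [hz.1 j hj]
    · have h1 := (neg_le_abs _).trans (hC₁' j hj _ (hπW z) hz.1)
      have h2 := mul_le_mul_of_nonneg_left (hz.2 j hj) (by linarith : (0 : ℝ) ≤ 1 - C₁ * δ)
      nlinarith
  have hle1 := measureReal_mono hsub1 (hfinT _ _)
  have hle2 := measureReal_mono hsub2 (ne_top_of_le_ne_top (hfinT _ _) (measure_mono hsub1))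
  rw [hvol, hvolT _ _ (by positivity) hδ.le] at hle1
  rw [hvol, hvolT _ _ (by linarith) hδ.le] at hle2
  have hu := one_add_pow_le d hx.le hδ₁.le
  have hl : 1 - 3 ^ d * (C₁ * δ) ≤ (1 - C₁ * δ) ^ d := by
    have h1 := one_add_mul_le_pow (a := -(C₁ * δ)) (by linarith) d
    have h2 : (d : ℝ) ≤ 3 ^ d := by
      exact_mod_cast (Nat.lt_pow_self (by norm_num : 1 < 3)).le
    have h3 : (1 + -(C₁ * δ)) ^ d = (1 - C₁ * δ) ^ d := by ring
    rw [h3] at h1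
    nlinarith
  have hcm : 0 ≤ δ ^ m * c := by positivity
  have hu' := mul_le_mul_of_nonneg_right hu hcm
  have hl' := mul_le_mul_of_nonneg_right hl hcm
  rw [abs_le, pow_succ]
  constructor <;> nlinarith

/-! ### The exponential measure of dilated polytopes -/

/-- The measure with density `exp (∑ i, u i)` on `ℝ^ι`; it is the image under the logarithm of the
measure with distribution function `∏ i, B i ^ ϖ i` that occurs in the main terms. -/
noncomputable def expMeasure (ι : Type*) [Fintype ι] : Measure (ι → ℝ) :=
  volume.withDensity fun u => ENNReal.ofReal (Real.exp (∑ i, u i))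

lemma expMeasure_Iic {ι : Type*} [Fintype ι] (b : ι → ℝ) :
    expMeasure ι (Set.Iic b) = ENNReal.ofReal (Real.exp (∑ i, b i)) := by
  let g : ι → ℝ → ℝ := fun i => (Set.Iic (b i)).indicator Real.exp
  have hg : ∀ u : ι → ℝ, (Set.Iic b).indicator (fun u => Real.exp (∑ i, u i)) u =
      ∏ i, g i (u i) := by
    intro u
    by_cases hu : u ∈ Set.Iic b
    · rw [Set.indicator_of_mem hu, Real.exp_sum]
      exact Finset.prod_congr rfl fun i _ =>
        (Set.indicator_of_mem (s := Set.Iic (b i)) (Set.mem_Iic.2 (hu i)) _).symm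
    · rw [Set.indicator_of_notMem hu]
      obtain ⟨i, hi⟩ : ∃ i, ¬ u i ≤ b i := by
        simpa [Pi.le_def] using hu
      exact (Finset.prod_eq_zero (Finset.mem_univ i)
        (Set.indicator_of_notMem (s := Set.Iic (b i)) hi _)).symm
  have hint : Integrable (fun u : ι → ℝ => ∏ i, g i (u i)) := by
    refine Integrable.fintype_prod fun i => ?_
    exact (integrable_indicator_iff measurableSet_Iic).2 (integrableOn_exp_Iic _)
  have hind : ∀ u : ι → ℝ, (Set.Iic b).indicator (fun u => ENNReal.ofReal (Real.exp (∑ i, u i))) u =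
      ENNReal.ofReal (∏ i, g i (u i)) := by
    intro u
    rw [← hg]
    by_cases hu : u ∈ Set.Iic b
    · rw [Set.indicator_of_mem hu, Set.indicator_of_mem hu]
    · rw [Set.indicator_of_notMem hu, Set.indicator_of_notMem hu, ENNReal.ofReal_zero]
  rw [expMeasure, withDensity_apply _ measurableSet_Iic, ← lintegral_indicator measurableSet_Iic]
  simp only [hind]
  rw [← ofReal_integral_eq_lintegral_ofReal hint
    (Filter.Eventually.of_forall fun u => by
      refine Finset.prod_nonneg fun i _ => Set.indicator_nonneg (fun _ _ => (Real.exp_pos _).le) _)]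
  congr 1
  rw [volume_pi, integral_fintype_prod_eq_prod, Real.exp_sum]
  refine Finset.prod_congr rfl fun i _ => ?_
  rw [integral_indicator measurableSet_Iic, integral_exp_Iic]

section Slices

variable {s : ℕ} (i₀ : Fin s)

/-- The linear part of `slicePoint`: the section of the projection that forgets the coordinate `i₀`,
with values in the hyperplane `∑ i, t i = 0`. -/
def sliceLin : ({j : Fin s // j ≠ i₀} → ℝ) →ₗ[ℝ] (Fin s → ℝ) where
  toFun τ i := if h : i = i₀ then -∑ j, τ j else τ ⟨i, h⟩
  map_add' x y := by
    ext i
    by_cases h : i = i₀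
    · simp [h, Finset.sum_add_distrib, add_comm]
    · simp [h]
  map_smul' r x := by
    ext i
    by_cases h : i = i₀
    · simp [h, Finset.mul_sum]
    · simp [h]

/-- The point of the hyperplane `∑ i, t i = c` that projects to `τ` when the coordinate `i₀` is
forgotten. -/
def slicePoint (c : ℝ) (τ : {j : Fin s // j ≠ i₀} → ℝ) : Fin s → ℝ :=
  sliceLin i₀ τ + c • Pi.single i₀ 1

lemma slicePoint_self (c : ℝ) (τ : {j : Fin s // j ≠ i₀} → ℝ) :
    slicePoint i₀ c τ i₀ = c - ∑ j, τ j := by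
  simp [slicePoint, sliceLin]; ring

lemma slicePoint_of_ne (c : ℝ) (τ : {j : Fin s // j ≠ i₀} → ℝ) (j : {j : Fin s // j ≠ i₀}) :
    slicePoint i₀ c τ j = τ j := by
  simp [slicePoint, sliceLin, j.2]

lemma sum_eq_add_sum_ne (t : Fin s → ℝ) :
    ∑ i, t i = t i₀ + ∑ j : {j : Fin s // j ≠ i₀}, t j :=
  Fintype.sum_eq_add_sum_subtype_ne t i₀

lemma sum_slicePoint (c : ℝ) (τ : {j : Fin s // j ≠ i₀} → ℝ) :
    ∑ i, slicePoint i₀ c τ i = c := by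
  rw [sum_eq_add_sum_ne i₀, slicePoint_self]
  simp only [slicePoint_of_ne]
  ring

lemma slicePoint_restrict {t : Fin s → ℝ} {c : ℝ} (ht : ∑ i, t i = c) :
    slicePoint i₀ c (fun j => t j) = t := by
  ext i
  by_cases h : i = i₀
  · subst h
    rw [slicePoint_self, ← ht, sum_eq_add_sum_ne i]; ring
  · exact slicePoint_of_ne i₀ c _ ⟨i, h⟩

lemma image_restrict_slice (P : Set (Fin s → ℝ)) (c : ℝ) :
    (fun (t : Fin s → ℝ) (j : {j : Fin s // j ≠ i₀}) => t j) '' {t | t ∈ P ∧ ∑ i, t i = c} =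
      {τ | slicePoint i₀ c τ ∈ P} := by
  ext τ
  constructor
  · rintro ⟨t, ⟨ht, hc⟩, rfl⟩
    change slicePoint i₀ c _ ∈ P
    rwa [slicePoint_restrict i₀ hc]
  · intro h
    exact ⟨_, ⟨h, sum_slicePoint i₀ c τ⟩, funext fun j => slicePoint_of_ne i₀ c τ j⟩

lemma measurable_slicePoint :
    Measurable fun z : ({j : Fin s // j ≠ i₀} → ℝ) × ℝ => slicePoint i₀ z.2 z.1 := by
  have h1 : Continuous fun z : ({j : Fin s // j ≠ i₀} → ℝ) × ℝ => sliceLin i₀ z.1 :=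
    (sliceLin i₀).continuous_of_finiteDimensional.comp continuous_fst
  have h2 : Continuous fun z : ({j : Fin s // j ≠ i₀} → ℝ) × ℝ => slicePoint i₀ z.2 z.1 := by
    unfold slicePoint
    fun_prop
  exact h2.measurable

lemma measurePreserving_slicePoint :
    MeasurePreserving (fun z : ({j : Fin s // j ≠ i₀} → ℝ) × ℝ => slicePoint i₀ z.2 z.1)
      (volume.prod volume) volume := by
  have h1 : MeasurePreserving
      (fun z : ({j : Fin s // j ≠ i₀} → ℝ) × ℝ => (z.1, z.2 - ∑ j, z.1 j))
      (volume.prod volume) (volume.prod volume) := by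
    refine MeasurePreserving.skew_product (f := id)
      (g := fun (τ : {j : Fin s // j ≠ i₀} → ℝ) (c : ℝ) => c - ∑ j, τ j)
      (μa := volume) (μb := volume) (μc := volume) (μd := volume)
      (MeasurePreserving.id _) ?_ ?_
    · simp only [Function.uncurry_def]; fun_prop
    · exact Filter.Eventually.of_forall fun τ => by
        simpa using (measurePreserving_sub_right volume (∑ j, τ j)).map_eq
  have h2 := (volume_preserving_piEquivPiSubtypeProd (fun _ : Fin s => ℝ)
    (fun i => i ≠ i₀)).symm
  have h3 : MeasurePreserving
      (fun z : ({j : Fin s // j ≠ i₀} → ℝ) × ℝ =>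
        ((z.1, fun _ => z.2) : ({j : Fin s // j ≠ i₀} → ℝ) × ({j : Fin s // ¬ j ≠ i₀} → ℝ)))
      (volume.prod volume) (volume.prod volume) := by
    have : Unique {j : Fin s // ¬ j ≠ i₀} :=
      ⟨⟨⟨i₀, by simp⟩⟩, fun j => Subtype.ext (not_not.1 j.2)⟩
    have h4 : MeasurePreserving (fun (c : ℝ) (_ : {j : Fin s // ¬ j ≠ i₀}) => c) := by
      have h5 := (volume_preserving_funUnique {j : Fin s // ¬ j ≠ i₀} ℝ).symm
      rw [Subsingleton.elim (Unique.fintype : Fintype {j : Fin s // ¬ j ≠ i₀})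
        (Subtype.fintype fun j => ¬ j ≠ i₀)] at h5
      exact h5
    exact (MeasurePreserving.id (volume : Measure ({j : Fin s // j ≠ i₀} → ℝ))).prod h4
  have h := h2.comp (h3.comp h1)
  refine (congrArg (fun F => MeasurePreserving F (volume.prod volume) volume) ?_).mpr h
  funext z i
  by_cases hi : i = i₀
  · subst hi
    rw [slicePoint_self]
    simp [MeasurableEquiv.piEquivPiSubtypeProd, Equiv.piEquivPiSubtypeProd]
  · rw [slicePoint_of_ne i₀ z.2 z.1 ⟨i, hi⟩]
    simp [MeasurableEquiv.piEquivPiSubtypeProd, Equiv.piEquivPiSubtypeProd, hi]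

/-- Fubini for the measure `exp (∑ i, u i) du` along the hyperplanes `∑ i, u i = c`. -/
lemma expMeasure_eq_lintegral_slice {Q : Set (Fin s → ℝ)} (hQ : MeasurableSet Q) :
    expMeasure (Fin s) Q =
      ∫⁻ c, ENNReal.ofReal (Real.exp c) * volume {τ | slicePoint i₀ c τ ∈ Q} := by
  have hm : Measurable (Q.indicator fun u => ENNReal.ofReal (Real.exp (∑ i, u i))) :=
    Measurable.indicator (by fun_prop) hQ
  rw [expMeasure, withDensity_apply _ hQ, ← lintegral_indicator hQ,
    ← (measurePreserving_slicePoint i₀).lintegral_comp hm]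
  rw [lintegral_prod_symm (fun z => Q.indicator _ (slicePoint i₀ z.2 z.1))
    (hm.comp (measurable_slicePoint i₀)).aemeasurable]
  refine lintegral_congr fun c => ?_
  have hQc : MeasurableSet {τ | slicePoint i₀ c τ ∈ Q} :=
    (measurable_slicePoint i₀).comp (measurable_id.prodMk measurable_const) hQ
  rw [← lintegral_indicator_const hQc]
  refine lintegral_congr fun τ => ?_
  by_cases h : slicePoint i₀ c τ ∈ Q
  · have h' : τ ∈ {τ | slicePoint i₀ c τ ∈ Q} := h
    rw [Set.indicator_of_mem h, Set.indicator_of_mem h', sum_slicePoint]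
  · have h' : τ ∉ {τ | slicePoint i₀ c τ ∈ Q} := h
    rw [Set.indicator_of_notMem h, Set.indicator_of_notMem h']

lemma measurable_volume_slice {Q : Set (Fin s → ℝ)} (hQ : MeasurableSet Q) :
    Measurable fun c => volume {τ | slicePoint i₀ c τ ∈ Q} :=
  measurable_measure_prodMk_right ((measurable_slicePoint i₀) hQ)

end Slices

lemma integrableOn_exp_neg_mul_pow (m : ℕ) :
    IntegrableOn (fun x : ℝ => Real.exp (-x) * x ^ m) (Set.Ioi 0) := by
  have := Real.GammaIntegral_convergent (s := m + 1) (by positivity)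
  simpa using this

lemma integral_exp_neg_mul_pow (m : ℕ) :
    ∫ x in Set.Ioi (0 : ℝ), Real.exp (-x) * x ^ m = m.factorial := by
  have := Real.Gamma_eq_integral (s := m + 1) (by positivity)
  rw [Real.Gamma_nat_eq_factorial] at this
  simpa using this.symm

/-- Watson's lemma, in the form in which the error term is dominated by a single power. -/
lemma abs_integral_exp_neg_mul_sub_le {h : ℝ → ℝ} (hm : Measurable h) {c C : ℝ} {m : ℕ}
    (hb : ∀ x, 0 < x → |h x - c * x ^ m| ≤ C * x ^ (m + 1)) :
    |(∫ x in Set.Ioi (0 : ℝ), Real.exp (-x) * h x) - c * m.factorial| ≤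
      C * (m + 1).factorial := by
  have h1 := (integrableOn_exp_neg_mul_pow m).const_mul c
  have h2 := (integrableOn_exp_neg_mul_pow (m + 1)).const_mul C
  have hbd : ∀ x ∈ Set.Ioi (0 : ℝ),
      ‖Real.exp (-x) * h x - c * (Real.exp (-x) * x ^ m)‖ ≤
        C * (Real.exp (-x) * x ^ (m + 1)) := by
    intro x hx
    have h3 : Real.exp (-x) * h x - c * (Real.exp (-x) * x ^ m) =
      Real.exp (-x) * (h x - c * x ^ m) := by ring
    rw [h3, norm_mul, Real.norm_of_nonneg (Real.exp_pos _).le, Real.norm_eq_abs]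
    calc _ ≤ Real.exp (-x) * (C * x ^ (m + 1)) := by gcongr; exact hb x hx
      _ = _ := by ring
  have hae : ∀ᵐ x ∂(volume.restrict (Set.Ioi (0 : ℝ))),
      ‖Real.exp (-x) * h x - c * (Real.exp (-x) * x ^ m)‖ ≤
        C * (Real.exp (-x) * x ^ (m + 1)) :=
    (ae_restrict_iff' measurableSet_Ioi).2 (Filter.Eventually.of_forall hbd)
  have h3 : Integrable (fun x => Real.exp (-x) * h x - c * (Real.exp (-x) * x ^ m))
      (volume.restrict (Set.Ioi (0 : ℝ))) :=
    h2.mono' (by fun_prop) hae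
  have h4 : Integrable (fun x => Real.exp (-x) * h x) (volume.restrict (Set.Ioi (0 : ℝ))) := by
    refine (h3.add h1).congr (Filter.Eventually.of_forall fun x => ?_)
    simp
  have h5 := norm_integral_le_of_norm_le h2 hae
  rw [integral_sub h4 h1, integral_const_mul, integral_const_mul, integral_exp_neg_mul_pow,
    integral_exp_neg_mul_pow] at h5
  exact h5

/-! ### Polytopes and the volumes of their slices -/

section

section Polyhedron

variable {ι κ : Type*} [Fintype ι]

/-- The linear forms in the inequalities that define `polyhedron`. -/
noncomputable def constraintForm (α : ι → κ → ℝ) (ϖ : ι → ℝ) : κ ⊕ ι → (ι → ℝ) →ₗ[ℝ] ℝ :=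
  Sum.elim (fun k => ∑ i, (α i k * (ϖ i)⁻¹) • LinearMap.proj i) fun i => -LinearMap.proj i

lemma polyhedron_eq_setOf (α : ι → κ → ℝ) (ϖ : ι → ℝ) (b : κ → ℝ) :
    polyhedron α ϖ b =
      {t | ∀ j, constraintForm α ϖ j t ≤ Sum.elim b (fun _ => 0) j} := by
  ext t
  simp [polyhedron, constraintForm]

lemma isClosed_polyhedron (α : ι → κ → ℝ) (ϖ : ι → ℝ) (b : κ → ℝ) :
    IsClosed (polyhedron α ϖ b) := by
  rw [polyhedron_eq_setOf]
  simp only [Set.ofPred_forall]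
  exact isClosed_iInter fun j =>
    isClosed_le (constraintForm α ϖ j).continuous_of_finiteDimensional continuous_const

lemma smul_mem_polyhedron_iff (α : ι → κ → ℝ) (ϖ : ι → ℝ) (b : κ → ℝ) {L : ℝ} (hL : 0 < L)
    (t : ι → ℝ) : L • t ∈ polyhedron α ϖ (fun k => L * b k) ↔ t ∈ polyhedron α ϖ b := by
  have h : ∀ k, ∑ i, α i k * (ϖ i)⁻¹ * (L * t i) = L * ∑ i, α i k * (ϖ i)⁻¹ * t i := fun k => by
    rw [Finset.mul_sum]; exact Finset.sum_congr rfl fun i _ => by ring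
  simp only [polyhedron, Set.mem_ofPred_eq, Pi.smul_apply, smul_eq_mul, h,
    mul_le_mul_iff_right₀ hL, mul_nonneg_iff_of_pos_left hL]

lemma zero_mem_polyhedron_one (α : ι → κ → ℝ) (ϖ : ι → ℝ) :
    (0 : ι → ℝ) ∈ polyhedron α ϖ (fun _ => 1) := by
  simp [polyhedron]

end Polyhedron

variable {s : ℕ} {κ : Type*}

lemma norm_le_norm_slicePoint (i₀ : Fin s) (c : ℝ) (τ : {j : Fin s // j ≠ i₀} → ℝ) :
    ‖τ‖ ≤ ‖slicePoint i₀ c τ‖ := by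
  refine (pi_norm_le_iff_of_nonneg (norm_nonneg _)).2 fun j => ?_
  rw [← slicePoint_of_ne i₀ c τ j]
  exact norm_le_pi_norm _ _

lemma finrank_vectorSpan_slice (i₀ : Fin s) (P : Set (Fin s → ℝ)) :
    Module.finrank ℝ (vectorSpan ℝ {τ | slicePoint i₀ (maxValue P) τ ∈ P}) = maxFaceDim P := by
  let f : ({j : Fin s // j ≠ i₀} → ℝ) →ᵃ[ℝ] (Fin s → ℝ) :=
    { toFun := slicePoint i₀ (maxValue P)
      linear := sliceLin i₀
      map_vadd' := fun τ v => by simp only [slicePoint, vadd_eq_add, map_add]; abel }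
  have himage : f '' {τ | slicePoint i₀ (maxValue P) τ ∈ P} = maxFace P := by
    ext t
    constructor
    · rintro ⟨τ, hτ, rfl⟩
      exact ⟨hτ, sum_slicePoint _ _ _⟩
    · rintro ⟨ht, hs⟩
      refine ⟨fun j => t j, ?_, slicePoint_restrict i₀ hs⟩
      change slicePoint i₀ _ _ ∈ P
      rwa [slicePoint_restrict i₀ hs]
  have hinj : Function.Injective (sliceLin i₀) := by
    intro x y hxy
    funext j
    have h1 := congrFun hxy j
    simpa [sliceLin, j.2] using h1
  rw [maxFaceDim, ← himage, ← AffineMap.map_vectorSpan]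
  exact ((Submodule.equivMapOfInjective _ hinj _).finrank_eq)

variable [Fintype κ]

/-- The volumes of the slices of a polytope near the face where `∑ i, t i` is maximal; the estimate
holds for every `δ > 0` since the slices have bounded volume. -/
lemma exists_slice_asymptotic (α : Fin s → κ → ℝ) (ϖ : Fin s → ℝ)
    (hbdd : Bornology.IsBounded (polyhedron α ϖ fun _ => 1)) (i₀ : Fin s) :
    maxFaceDim (polyhedron α ϖ fun _ => 1) ≤ s - 1 ∧
    ∃ c C : ℝ, 0 ≤ C ∧ ∀ δ : ℝ, 0 < δ →
      |volume.real {τ | slicePoint i₀ (maxValue (polyhedron α ϖ fun _ => 1) - δ) τ ∈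
            polyhedron α ϖ fun _ => 1} -
          c * δ ^ (s - 1 - maxFaceDim (polyhedron α ϖ fun _ => 1))| ≤
        C * δ ^ (s - 1 - maxFaceDim (polyhedron α ϖ fun _ => 1) + 1) := by
  set P := polyhedron α ϖ fun _ => 1 with hP
  set a := maxValue P
  set k := maxFaceDim P
  have hcomp : IsCompact P :=
    Metric.isCompact_of_isClosed_isBounded (isClosed_polyhedron _ _ _) hbdd
  obtain ⟨x₀, hx₀, hx₀a, -⟩ := exists_isMaxOn_of_isCompact hcomp ⟨0, zero_mem_polyhedron_one α ϖ⟩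
  obtain ⟨R, hR⟩ := hbdd.exists_norm_le
  have hball : ∀ c, {τ | slicePoint i₀ c τ ∈ P} ⊆ Metric.closedBall 0 R := fun c τ hτ => by
    rw [mem_closedBall_zero_iff]
    exact (norm_le_norm_slicePoint i₀ c τ).trans (hR _ hτ)
  let f := constraintForm α ϖ
  let v : Fin s → ℝ := Pi.single i₀ 1
  let M : κ ⊕ Fin s → ({j : Fin s // j ≠ i₀} → ℝ) →ₗ[ℝ] ℝ := fun j => (f j).comp (sliceLin i₀)
  let β : κ ⊕ Fin s → ℝ := Sum.elim (fun _ => 1) fun _ => 0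
  have hslice : ∀ c, {τ | slicePoint i₀ c τ ∈ P} = {τ | ∀ j, M j τ ≤ β j - c * f j v} := by
    intro c
    ext τ
    rw [hP, polyhedron_eq_setOf]
    refine forall_congr' fun j => ?_
    have : f j (slicePoint i₀ c τ) = M j τ + c * f j v := by
      simp only [slicePoint, map_add, map_smul, smul_eq_mul]; rfl
    change f j (slicePoint i₀ c τ) ≤ β j ↔ _
    rw [this, le_sub_iff_add_le]
  have hG0 := hslice a
  have hdim := finrank_vectorSpan_slice i₀ P
  have hcard : Fintype.card {j : Fin s // j ≠ i₀} = s - 1 := by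
    rw [Fintype.card_subtype_compl, Fintype.card_fin, Fintype.card_unique]
  have hk : k ≤ s - 1 := by
    rw [← hcard, ← Module.finrank_fintype_fun_eq_card ℝ]
    exact hdim.symm.trans_le (Submodule.finrank_le _)
  refine ⟨hk, ?_⟩
  obtain ⟨c, C, δ₀, hC, hδ₀, h⟩ := exists_volume_asymptotic M (fun j => β j - a * f j v)
    (fun j => f j v) (by
      rw [← hG0]
      exact ⟨fun j => x₀ j, by
        change slicePoint i₀ a _ ∈ P
        rwa [slicePoint_restrict i₀ hx₀a]⟩)
    (by rw [← hG0]; exact Metric.isBounded_closedBall.subset (hball a))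
  rw [← hG0, hdim, hcard] at h
  set m := s - 1 - k
  set V := volume.real (Metric.closedBall (0 : {j : Fin s // j ≠ i₀} → ℝ) R)
  refine ⟨c, C + (V / δ₀ ^ (m + 1) + |c| / δ₀), by positivity, fun δ hδ => ?_⟩
  have hpos : 0 ≤ V / δ₀ ^ (m + 1) + |c| / δ₀ := by positivity
  rcases lt_or_ge δ δ₀ with hlt | hge
  · have h1 := h δ hδ hlt
    have h2 : {x | ∀ j, M j x ≤ β j - a * f j v + δ * f j v} =
        {τ | slicePoint i₀ (a - δ) τ ∈ P} := by
      rw [hslice]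
      ext x
      refine forall_congr' fun j => ?_
      rw [sub_mul, sub_sub_eq_add_sub, sub_add_eq_add_sub, add_comm (β j)]
    rw [h2] at h1
    refine h1.trans ?_
    gcongr
    linarith
  · have h1 : volume.real {τ | slicePoint i₀ (a - δ) τ ∈ P} ≤ V :=
      measureReal_mono (hball _) Metric.isBounded_closedBall.measure_lt_top.ne
    have h0 : 0 ≤ volume.real {τ | slicePoint i₀ (a - δ) τ ∈ P} := measureReal_nonneg
    have h2 : V ≤ V / δ₀ ^ (m + 1) * δ ^ (m + 1) := by
      rw [div_mul_eq_mul_div, le_div_iff₀ (by positivity)]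
      gcongr
    have h3 : |c| * δ ^ m ≤ |c| / δ₀ * δ ^ (m + 1) := by
      rw [div_mul_eq_mul_div, le_div_iff₀ hδ₀, pow_succ, mul_assoc]
      gcongr
    have h4 : |c * δ ^ m| = |c| * δ ^ m := by
      rw [abs_mul, abs_of_nonneg (by positivity : 0 ≤ δ ^ m)]
    calc _ ≤ |volume.real {τ | slicePoint i₀ (a - δ) τ ∈ P}| + |c * δ ^ m| := abs_sub _ _
      _ ≤ V + |c| * δ ^ m := by rw [abs_of_nonneg h0, h4]; gcongr
      _ ≤ (V / δ₀ ^ (m + 1) + |c| / δ₀) * δ ^ (m + 1) := by rw [add_mul]; gcongr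
      _ ≤ _ := mul_le_mul_of_nonneg_right (le_add_of_nonneg_left hC) (by positivity)

/-- The leading term of the exponential measure of the dilates of a polytope is given by the leading
constant of the volumes of its slices. -/
lemma exists_expMeasure_asymptotic (α : Fin s → κ → ℝ) (ϖ : Fin s → ℝ)
    (hbdd : Bornology.IsBounded (polyhedron α ϖ fun _ => 1)) (i₀ : Fin s) {c C : ℝ}
    (h : ∀ δ : ℝ, 0 < δ →
      |volume.real {τ | slicePoint i₀ (maxValue (polyhedron α ϖ fun _ => 1) - δ) τ ∈
            polyhedron α ϖ fun _ => 1} -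
          c * δ ^ (s - 1 - maxFaceDim (polyhedron α ϖ fun _ => 1))| ≤
        C * δ ^ (s - 1 - maxFaceDim (polyhedron α ϖ fun _ => 1) + 1)) :
    ∃ C' : ℝ, ∀ L : ℝ, 0 < L →
      |(expMeasure (Fin s)).real (polyhedron α ϖ fun _ => L) -
          (s - 1 - maxFaceDim (polyhedron α ϖ fun _ => 1)).factorial * c *
            (L ^ maxFaceDim (polyhedron α ϖ fun _ => 1) *
              Real.exp (maxValue (polyhedron α ϖ fun _ => 1) * L))| ≤
        C' * (L ^ maxFaceDim (polyhedron α ϖ fun _ => 1) / L *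
          Real.exp (maxValue (polyhedron α ϖ fun _ => 1) * L)) := by
  have hk := (exists_slice_asymptotic α ϖ hbdd i₀).1
  set P := polyhedron α ϖ fun _ => 1 with hP
  set a := maxValue P
  set k := maxFaceDim P
  set m := s - 1 - k with hm
  refine ⟨C * (m + 1).factorial, fun L hL => ?_⟩
  set Q : Set (Fin s → ℝ) := polyhedron α ϖ fun _ => L
  have hcomp : IsCompact P :=
    Metric.isCompact_of_isClosed_isBounded (isClosed_polyhedron _ _ _) hbdd
  obtain ⟨x₀, -, -, hmax⟩ := exists_isMaxOn_of_isCompact hcomp ⟨0, zero_mem_polyhedron_one α ϖ⟩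
  have hcard : Fintype.card {j : Fin s // j ≠ i₀} = s - 1 := by
    rw [Fintype.card_subtype_compl, Fintype.card_fin, Fintype.card_unique]
  let g : ℝ → ℝ := fun c => volume.real {τ | slicePoint i₀ c τ ∈ P}
  have hQm : MeasurableSet Q := (isClosed_polyhedron _ _ _).measurableSet
  have hPm : MeasurableSet P := (isClosed_polyhedron _ _ _).measurableSet
  have hgm : Measurable g := (measurable_volume_slice i₀ hPm).ennreal_toReal
  -- The slices of the dilate are dilates of slices.
  have hvol : ∀ c, volume {τ | slicePoint i₀ c τ ∈ Q} =
      ENNReal.ofReal (L ^ (s - 1)) * volume {τ | slicePoint i₀ (c / L) τ ∈ P} := by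
    intro c
    have h1 : {τ | slicePoint i₀ c τ ∈ Q} =
        (fun τ => L⁻¹ • τ) ⁻¹' {τ | slicePoint i₀ (c / L) τ ∈ P} := by
      ext τ
      have h2 : slicePoint i₀ c τ = L • slicePoint i₀ (c / L) (L⁻¹ • τ) := by
        simp only [slicePoint, map_smul, smul_add, smul_smul]
        rw [mul_inv_cancel₀ hL.ne', one_smul, mul_div_cancel₀ _ hL.ne']
      change slicePoint i₀ c τ ∈ Q ↔ slicePoint i₀ (c / L) (L⁻¹ • τ) ∈ P
      have h3 := smul_mem_polyhedron_iff α ϖ (fun _ => 1) hL (slicePoint i₀ (c / L) (L⁻¹ • τ))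
      simp only [mul_one] at h3
      rw [h2]
      exact h3
    rw [h1, Measure.addHaar_preimage_smul _ (inv_ne_zero hL.ne'),
      Module.finrank_fintype_fun_eq_card, hcard, inv_pow, inv_inv, abs_of_pos (by positivity)]
  have hfin : ∀ c, volume {τ | slicePoint i₀ c τ ∈ P} < ⊤ := by
    intro c
    obtain ⟨R, hR⟩ := hbdd.exists_norm_le
    refine Bornology.IsBounded.measure_lt_top (isBounded_iff_forall_norm_le.2 ⟨R, fun τ hτ => ?_⟩)
    exact (norm_le_norm_slicePoint i₀ c τ).trans (hR _ hτ)
  have hg0 : ∀ c, a < c → g c = 0 := by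
    intro c hc
    have : {τ | slicePoint i₀ c τ ∈ P} = ∅ := by
      refine Set.eq_empty_iff_forall_notMem.2 fun τ hτ => ?_
      have := hmax _ hτ
      rw [sum_slicePoint] at this
      linarith
    simp only [g, this, measureReal_empty]
  have hI : (expMeasure (Fin s)).real Q =
      L ^ (s - 1) * Real.exp (a * L) *
        ∫ x in Set.Ioi (0 : ℝ), Real.exp (-x) * g (a - x / L) := by
    have h1 : (expMeasure (Fin s)).real Q = ∫ c, Real.exp c * (L ^ (s - 1) * g (c / L)) := by
      rw [Measure.real, expMeasure_eq_lintegral_slice i₀ hQm, ← integral_toReal]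
      · refine integral_congr_ae (Filter.Eventually.of_forall fun c => ?_)
        simp only [hvol, ENNReal.toReal_mul, ENNReal.toReal_ofReal (Real.exp_pos c).le,
          ENNReal.toReal_ofReal (by positivity : (0 : ℝ) ≤ L ^ (s - 1))]
        rfl
      · exact ((by fun_prop : Measurable fun c : ℝ => ENNReal.ofReal (Real.exp c)).mul
          (measurable_volume_slice i₀ hQm)).aemeasurable
      · refine Filter.Eventually.of_forall fun c => ?_
        rw [hvol]
        exact ENNReal.mul_lt_top ENNReal.ofReal_lt_top
          (ENNReal.mul_lt_top ENNReal.ofReal_lt_top (hfin _))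
    rw [h1, ← integral_sub_left_eq_self _ volume (a * L), ← integral_const_mul,
      ← integral_Ici_eq_integral_Ioi, ← setIntegral_eq_integral_of_forall_compl_eq_zero
        (s := Set.Ici (0 : ℝ))]
    · refine setIntegral_congr_fun measurableSet_Ici fun x _ => ?_
      have h2 : (a * L - x) / L = a - x / L := by field_simp
      change Real.exp (a * L - x) * (L ^ (s - 1) * g ((a * L - x) / L)) = _
      rw [h2, sub_eq_add_neg (a * L) x, Real.exp_add]
      ring
    · intro x hx
      have hx' : x < 0 := by simpa using hx
      have h2 : (a * L - x) / L = a - x / L := by field_simp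
      have h3 : a < (a * L - x) / L := by
        rw [h2]; linarith [div_neg_of_neg_of_pos hx' hL]
      rw [hg0 _ h3]; simp
  have hW := abs_integral_exp_neg_mul_sub_le (h := fun x => g (a - x / L)) (by fun_prop)
    (c := c / L ^ m) (C := C / L ^ (m + 1)) (m := m) (fun x hx => by
      have h1 := h (x / L) (by positivity)
      rw [div_pow, div_pow] at h1
      have h2 : c / L ^ m * x ^ m = c * (x ^ m / L ^ m) := by ring
      have h3 : C / L ^ (m + 1) * x ^ (m + 1) = C * (x ^ (m + 1) / L ^ (m + 1)) := by ring
      rw [h2, h3]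
      exact h1)
  have hpow : L ^ (s - 1) = L ^ k * L ^ m := by rw [← pow_add]; congr 1; omega
  rw [hI, hpow]
  have h1 : L ^ k * L ^ m * Real.exp (a * L) *
        (∫ x in Set.Ioi (0 : ℝ), Real.exp (-x) * g (a - x / L)) -
      m.factorial * c * (L ^ k * Real.exp (a * L)) =
      L ^ k * L ^ m * Real.exp (a * L) *
        ((∫ x in Set.Ioi (0 : ℝ), Real.exp (-x) * g (a - x / L)) -
          c / L ^ m * m.factorial) := by
    field_simp
  rw [h1, abs_mul, abs_of_pos (by positivity)]
  calc _ ≤ L ^ k * L ^ m * Real.exp (a * L) * (C / L ^ (m + 1) * (m + 1).factorial) := by gcongr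
    _ = _ := by rw [pow_succ L m]; field_simp

end

/-! ### The part of the dilated polytope near the coordinate hyperplanes -/

section

lemma sum_coe_add_sum_notMem {ι : Type*} [Fintype ι] [DecidableEq ι] (J : Finset ι) (g : ι → ℝ) :
    ∑ i : J, g i + ∑ i : {i // i ∉ J}, g i = ∑ i, g i := by
  rw [Finset.sum_coe_sort J g, ← Finset.sum_subtype Jᶜ (fun i => by simp) g,
    Finset.sum_add_sum_compl]

variable {s : ℕ} {κ : Type*}

lemma fiberPolytope_bound_eq {α : Fin s → κ → ℝ} {L : ℝ} {J : Finset (Fin s)}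
    (y : {i : Fin s // i ∉ J} → ℕ+) (k : κ) :
    Real.log (Real.exp L * ∏ i : {i : Fin s // i ∉ J}, ((y i : ℕ) : ℝ) ^ (-α i k)) /
        Real.log (Real.exp L) =
      (L - ∑ i : {i : Fin s // i ∉ J}, α i k * Real.log (y i : ℕ)) / L := by
  have hy : ∀ i, (0 : ℝ) < ((y i : ℕ) : ℝ) := fun i => by exact_mod_cast (y i).pos
  rw [Real.log_mul (Real.exp_pos _).ne'
    (Finset.prod_ne_zero_iff.2 fun i _ => (Real.rpow_pos_of_pos (hy i) _).ne'), Real.log_exp,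
    Real.log_prod (fun i _ => (Real.rpow_pos_of_pos (hy i) _).ne'), sub_eq_add_neg,
    ← Finset.sum_neg_distrib]
  congr 2
  exact Finset.sum_congr rfl fun i _ => by rw [Real.log_rpow (hy i)]; ring

/-- A point of the fibre `P^J(y)`, completed by the logarithmic coordinates of `y`, is a point of
the full polytope. -/
lemma extend_mem_polyhedron {α : Fin s → κ → ℝ} {ϖ : Fin s → ℝ} (hϖ : ∀ i, 0 < ϖ i) {L : ℝ}
    (hL : 0 < L) {J : Finset (Fin s)} {y : {i : Fin s // i ∉ J} → ℕ+} {x : J → ℝ}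
    (hx : x ∈ fiberPolytope α ϖ (Real.exp L) J y) :
    (fun i => if h : i ∈ J then x ⟨i, h⟩ else ϖ i * Real.log (y ⟨i, h⟩ : ℕ) / L) ∈
      polyhedron α ϖ fun _ => 1 := by
  refine ⟨fun k => ?_, fun i => ?_⟩
  · have h1 := hx.1 k
    simp only [fiberPolytope_bound_eq] at h1
    rw [← sum_coe_add_sum_notMem J]
    have h2 : ∀ i : J, (if h : (i : Fin s) ∈ J then x ⟨i, h⟩
        else ϖ i * Real.log (y ⟨i, h⟩ : ℕ) / L) = x i := fun i => by simp
    have h3 : ∀ i : {i // i ∉ J}, α i k * (ϖ i)⁻¹ * (if h : (i : Fin s) ∈ J then x ⟨i, h⟩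
        else ϖ i * Real.log (y ⟨i, h⟩ : ℕ) / L) = α i k * Real.log (y i : ℕ) / L := fun i => by
      have := (hϖ i).ne'
      rw [dif_neg i.2]
      field_simp
    simp only [h2, h3]
    rw [← Finset.sum_div]
    rw [sub_div, div_self hL.ne'] at h1
    linarith
  · by_cases h : i ∈ J
    · simp only [h, dif_pos]
      exact hx.2 ⟨i, h⟩
    · simp only [h, dif_neg, not_false_eq_true]
      have := (hϖ i).le
      have : 0 ≤ Real.log (y ⟨i, h⟩ : ℕ) := Real.log_natCast_nonneg _
      positivity

lemma half_le_natFloor {x : ℝ} (hx : 1 ≤ x) : x / 2 ≤ ⌊x⌋₊ := by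
  have h1 := Nat.lt_floor_add_one x
  have h2 : (1 : ℝ) ≤ ⌊x⌋₊ := by exact_mod_cast Nat.one_le_floor_iff x |>.2 hx
  linarith

variable [Fintype κ]

/-- The contribution of the integer points with a prescribed set `J` of large coordinates and with
prescribed small coordinates `z i`, `i ∉ J`. If the maximum on the fibre is close to the global one,
the geometric assumption saves a factor `L`; otherwise the smaller maximum does. -/
lemma sum_exp_le_of_fiber {α : Fin s → κ → ℝ} (hα : ∀ i k, 0 ≤ α i k) {ϖ : Fin s → ℝ}
    (hϖ : ∀ i, 0 < ϖ i) (hbdd : Bornology.IsBounded (polyhedron α ϖ fun _ => 1)) {A N C₁₀ : ℝ}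
    (hA : 0 ≤ A) (hN : ∀ i, A ≤ N * ϖ i) (hC₁₀ : s * A + s + 1 ≤ C₁₀) :
    ∃ C : ℝ, 0 ≤ C ∧ ∀ (J : Finset (Fin s)) (z : Fin s → ℕ) (L : ℝ), 1 ≤ L →
      (∀ i ∉ J, (z i : ℝ) ≤ A * Real.log L) →
      (∀ y : {i : Fin s // i ∉ J} → ℕ+, (∀ i, ((y i : ℕ) : ℝ) ≤ L ^ N) →
        maxValue (polyhedron α ϖ (fun _ => 1)) - C₁₀ * (Real.log L / L) ≤
            maxValue (fiberPolytope α ϖ (Real.exp L) J y) →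
        maxFaceDim (fiberPolytope α ϖ (Real.exp L) J y) <
          maxFaceDim (polyhedron α ϖ (fun _ => 1))) →
      ∀ T : Finset (Fin s → ℕ), (∀ n ∈ T, (fun i => (n i : ℝ)) ∈ polyhedron α ϖ (fun _ => L) ∧
          ∀ i ∉ J, n i = z i) →
        ∑ n ∈ T, Real.exp (∑ i, (n i : ℝ)) ≤
          C * (L ^ maxFaceDim (polyhedron α ϖ fun _ => 1) / L *
            Real.exp (maxValue (polyhedron α ϖ fun _ => 1) * L)) := by
  classical
  set P := polyhedron α ϖ fun _ => 1 with hP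
  set a := maxValue P
  set k := maxFaceDim P
  have hcompP : IsCompact P :=
    Metric.isCompact_of_isClosed_isBounded (isClosed_polyhedron _ _ _) hbdd
  obtain ⟨-, -, -, hmax⟩ := exists_isMaxOn_of_isCompact hcompP ⟨0, zero_mem_polyhedron_one α ϖ⟩
  obtain ⟨R, hR⟩ := hbdd.exists_norm_le
  have hR0 : 0 ≤ R := (norm_nonneg _).trans (hR 0 (zero_mem_polyhedron_one α ϖ))
  have hU := fun J : Finset (Fin s) =>
    exists_sum_exp_le_of_polytope (constraintForm (fun i : J => α i) fun i : J => ϖ i) hR0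
  choose U hU0 hU using hU
  set E := Real.exp (∑ i, ϖ i * Real.log 2)
  have hE : 1 ≤ E := Real.one_le_exp (Finset.sum_nonneg fun i _ =>
    mul_nonneg (hϖ i).le (Real.log_nonneg one_le_two))
  have hUsum : ∀ J, U J ≤ ∑ J, U J := fun J =>
    Finset.single_le_sum (fun J _ => hU0 J) (Finset.mem_univ J)
  have hUs : 0 ≤ ∑ J, U J := Finset.sum_nonneg fun J _ => hU0 J
  refine ⟨(∑ J, U J) * E, by positivity, fun J z L hL hz hface T hT => ?_⟩
  have hL0 : 0 < L := by linarith
  rcases T.eq_empty_or_nonempty with rfl | ⟨n₀, hn₀⟩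
  · simp only [Finset.sum_empty]
    positivity
  have hlogL : 0 ≤ Real.log L := Real.log_nonneg hL
  -- The integers `y i` approximate the numbers whose logarithmic coordinates are the `z i`.
  have hfl : ∀ i, 0 < ⌊Real.exp (z i / ϖ i)⌋₊ := fun i => by
    refine Nat.floor_pos.2 (Real.one_le_exp ?_)
    have := hϖ i
    positivity
  let y : {i : Fin s // i ∉ J} → ℕ+ := fun i => ⟨⌊Real.exp (z i / ϖ i)⌋₊, hfl i⟩
  have hyv : ∀ i, ((y i : ℕ) : ℝ) = ⌊Real.exp (z i / ϖ i)⌋₊ := fun i => rfl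
  have hyle : ∀ i, ((y i : ℕ) : ℝ) ≤ Real.exp (z i / ϖ i) := fun i =>
    Nat.floor_le (Real.exp_pos _).le
  have hypos : ∀ i, (0 : ℝ) < ((y i : ℕ) : ℝ) := fun i => by exact_mod_cast (y i).pos
  have hylog : ∀ i, Real.log (y i : ℕ) ≤ z i / ϖ i := fun i => by
    rw [Real.log_le_iff_le_exp (hypos i)]; exact hyle i
  have hylog' : ∀ i : {i // i ∉ J}, (z i : ℝ) ≤ ϖ i * Real.log (y i : ℕ) + ϖ i * Real.log 2 := by
    intro i
    have hw := hϖ i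
    have h1 : Real.exp (z i / ϖ i) / 2 ≤ ((y i : ℕ) : ℝ) :=
      half_le_natFloor (Real.one_le_exp (by positivity))
    have h2 := Real.log_le_log (by positivity) h1
    rw [Real.log_div (Real.exp_pos _).ne' two_ne_zero, Real.log_exp] at h2
    have h3 : (z i : ℝ) / ϖ i ≤ Real.log (y i : ℕ) + Real.log 2 := by linarith
    rw [div_le_iff₀ hw] at h3
    linarith
  have hyN : ∀ i, ((y i : ℕ) : ℝ) ≤ L ^ N := by
    intro i
    refine (hyle i).trans ?_
    rw [Real.rpow_def_of_pos hL0, Real.exp_le_exp, div_le_iff₀ (hϖ i)]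
    calc (z i : ℝ) ≤ A * Real.log L := hz i i.2
      _ ≤ N * ϖ i * Real.log L := by gcongr; exact hN i
      _ = _ := by ring
  set G := fiberPolytope α ϖ (Real.exp L) J y with hGdef
  have hGeq := polyhedron_eq_setOf (fun i : J => α i) (fun i : J => ϖ i)
    (fun k => Real.log (Real.exp L * ∏ i : {i : Fin s // i ∉ J}, ((y i : ℕ) : ℝ) ^ (-α i k)) /
      Real.log (Real.exp L))
  have hext := fun (x : J → ℝ) (hx : x ∈ G) => extend_mem_polyhedron hϖ hL0 hx
  have hGbox : ∀ x ∈ G, ∀ i, 0 ≤ x i ∧ x i ≤ R := by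
    intro x hx i
    refine ⟨hx.2 i, ?_⟩
    have h1 := (norm_le_pi_norm _ (i : Fin s)).trans (hR _ (hext x hx))
    simp only [Finset.coe_mem, dif_pos] at h1
    exact (le_abs_self _).trans h1
  have hGsum : ∀ x ∈ G, L * ∑ i, x i + ∑ i : {i // i ∉ J}, ϖ i * Real.log (y i : ℕ) ≤ a * L := by
    intro x hx
    have h1 := hmax _ (hext x hx)
    rw [← sum_coe_add_sum_notMem J] at h1
    have h2 : ∀ i : J, (if h : (i : Fin s) ∈ J then x ⟨i, h⟩
        else ϖ i * Real.log (y ⟨i, h⟩ : ℕ) / L) = x i := fun i => by simp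
    have h3 : ∀ i : {i // i ∉ J}, (if h : (i : Fin s) ∈ J then x ⟨i, h⟩
        else ϖ i * Real.log (y ⟨i, h⟩ : ℕ) / L) = ϖ i * Real.log (y i : ℕ) / L := fun i => by
      rw [dif_neg i.2]
    simp only [h2, h3] at h1
    rw [← Finset.sum_div] at h1
    have h4 := mul_le_mul_of_nonneg_right h1 hL0.le
    rw [add_mul, div_mul_cancel₀ _ hL0.ne'] at h4
    linarith
  have hGmem : ∀ n ∈ T, (fun i : J => (n i : ℝ) / L) ∈ G := by
    intro n hn
    obtain ⟨h1, h2⟩ := hT n hn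
    refine ⟨fun k => ?_, fun i => by positivity⟩
    simp only [fiberPolytope_bound_eq]
    have h3 := h1.1 k
    rw [← sum_coe_add_sum_notMem J] at h3
    have h4 : ∑ i : {i // i ∉ J}, α i k * Real.log (y i : ℕ) ≤
        ∑ i : {i // i ∉ J}, α i k * (ϖ i)⁻¹ * n i := by
      refine Finset.sum_le_sum fun i _ => ?_
      rw [h2 i i.2, mul_assoc, inv_mul_eq_div]
      exact mul_le_mul_of_nonneg_left (hylog i) (hα i k)
    rw [le_div_iff₀ hL0, Finset.sum_mul]
    have h5 : ∀ i : J, α i k * (ϖ i)⁻¹ * ((n i : ℝ) / L) * L = α i k * (ϖ i)⁻¹ * n i := fun i => by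
      rw [mul_assoc, div_mul_cancel₀ _ hL0.ne']
    simp only [h5]
    linarith
  -- The sum over the fibre is a sum over the coordinates in `J`.
  let r : (Fin s → ℕ) → J → ℕ := fun n i => n i
  have hr : Set.InjOn r T := by
    intro n hn n' hn' h
    funext i
    by_cases hi : i ∈ J
    · exact congrFun h ⟨i, hi⟩
    · rw [(hT n hn).2 i hi, (hT n' hn').2 i hi]
  set Z : ℝ := ∑ i : {i // i ∉ J}, (z i : ℝ)
  have hsplit : ∑ n ∈ T, Real.exp (∑ i, (n i : ℝ)) =
      Real.exp Z * ∑ m ∈ T.image r, Real.exp (∑ i, (m i : ℝ)) := by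
    rw [Finset.sum_image hr, Finset.mul_sum]
    refine Finset.sum_congr rfl fun n hn => ?_
    rw [← Real.exp_add, ← sum_coe_add_sum_notMem J, add_comm]
    congr 2
    exact Finset.sum_congr rfl fun i _ => by rw [(hT n hn).2 i i.2]
  have hmain := hU J _ G hGeq hGbox L hL (T.image r) (by
    intro m hm
    obtain ⟨n, hn, rfl⟩ := Finset.mem_image.1 hm
    exact hGmem n hn)
  have hGcomp : IsCompact G :=
    (isCompact_univ_pi fun _ : J => isCompact_Icc (a := 0) (b := R)).of_isClosed_subset
      (isClosed_polyhedron _ _ _) fun x hx i _ => hGbox x hx i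
  obtain ⟨x, hx, hxa, -⟩ := exists_isMaxOn_of_isCompact hGcomp ⟨_, hGmem n₀ hn₀⟩
  have haG := hGsum x hx
  rw [hxa] at haG
  have hZ : Z ≤ ∑ i : {i // i ∉ J}, ϖ i * Real.log (y i : ℕ) + ∑ i, ϖ i * Real.log 2 := by
    have h1 : ∑ i : {i // i ∉ J}, ϖ i * Real.log 2 ≤ ∑ i, ϖ i * Real.log 2 := by
      rw [← sum_coe_add_sum_notMem J (fun i => ϖ i * Real.log 2)]
      have : 0 ≤ ∑ i : J, ϖ i * Real.log 2 := Finset.sum_nonneg fun i _ =>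
        mul_nonneg (hϖ i).le (Real.log_nonneg one_le_two)
      linarith
    refine le_trans ?_ (add_le_add_right h1 _)
    rw [← Finset.sum_add_distrib]
    exact Finset.sum_le_sum fun i _ => hylog' i
  have hbound : L ^ maxFaceDim G * (Real.exp Z * Real.exp (L * maxValue G)) ≤
      E * (L ^ k / L * Real.exp (a * L)) := by
    rcases le_or_gt (a - C₁₀ * (Real.log L / L)) (maxValue G) with h | h
    · have hdim : maxFaceDim G + 1 ≤ k := hface y hyN h
      have h1 : L ^ maxFaceDim G ≤ L ^ k / L := by
        rw [le_div_iff₀ hL0, ← pow_succ]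
        exact pow_le_pow_right₀ hL hdim
      have h2 : Real.exp Z * Real.exp (L * maxValue G) ≤ E * Real.exp (a * L) := by
        rw [← Real.exp_add, ← Real.exp_add, Real.exp_le_exp]
        linarith
      calc _ ≤ L ^ k / L * (E * Real.exp (a * L)) := by gcongr
        _ = _ := by ring
    · have hdim : maxFaceDim G ≤ s := by
        refine (Submodule.finrank_le _).trans ?_
        rw [Module.finrank_fintype_fun_eq_card, Fintype.card_coe]
        simpa using J.card_le_univ
      have h1 : L ^ maxFaceDim G ≤ Real.exp (s * Real.log L) := by
        rw [mul_comm, ← Real.rpow_def_of_pos hL0, Real.rpow_natCast]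
        exact pow_le_pow_right₀ hL hdim
      have h2 : Z ≤ s * (A * Real.log L) := by
        have h3 : ∀ i ∈ (Finset.univ : Finset {i // i ∉ J}), (z i : ℝ) ≤ A * Real.log L :=
          fun i _ => hz i i.2
        refine (Finset.sum_le_card_nsmul _ _ _ h3).trans ?_
        rw [nsmul_eq_mul]
        have h4 : Fintype.card {i // i ∉ J} ≤ s :=
          (Fintype.card_subtype_le fun i : Fin s => i ∉ J).trans_eq (Fintype.card_fin s)
        have : 0 ≤ A * Real.log L := by positivity
        gcongr
        exact h4
      have h3 : L * maxValue G ≤ a * L - C₁₀ * Real.log L := by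
        have := mul_le_mul_of_nonneg_left h.le hL0.le
        have h5 : L * (a - C₁₀ * (Real.log L / L)) = a * L - C₁₀ * Real.log L := by field_simp
        linarith
      have h4 : 1 / L = Real.exp (-Real.log L) := by
        rw [Real.exp_neg, Real.exp_log hL0, one_div]
      calc L ^ maxFaceDim G * (Real.exp Z * Real.exp (L * maxValue G))
          ≤ Real.exp (s * Real.log L) * (Real.exp (s * (A * Real.log L)) *
              Real.exp (a * L - C₁₀ * Real.log L)) := by gcongr
        _ ≤ 1 / L * Real.exp (a * L) := by
            rw [h4, ← Real.exp_add, ← Real.exp_add, ← Real.exp_add, Real.exp_le_exp]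
            nlinarith [mul_le_mul_of_nonneg_right hC₁₀ hlogL]
        _ ≤ 1 * (L ^ k / L * Real.exp (a * L)) := by
            rw [one_mul]
            gcongr
            exact one_le_pow₀ hL
        _ ≤ _ := by gcongr
  rw [hsplit]
  calc Real.exp Z * ∑ m ∈ T.image r, Real.exp (∑ i, (m i : ℝ))
      ≤ Real.exp Z * (U J * L ^ maxFaceDim G * Real.exp (L * maxValue G)) := by gcongr
    _ = U J * (L ^ maxFaceDim G * (Real.exp Z * Real.exp (L * maxValue G))) := by ring
    _ ≤ (∑ J, U J) * (E * (L ^ k / L * Real.exp (a * L))) := by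
        gcongr
        exact hUsum J
    _ = _ := by ring

/-- The integer points of the dilated polytope that have a coordinate of size at most `A * log L`
contribute little to the exponential sum. -/
lemma exists_sum_exp_small_coordinate_le {α : Fin s → κ → ℝ} (hα : ∀ i k, 0 ≤ α i k)
    {ϖ : Fin s → ℝ} (hϖ : ∀ i, 0 < ϖ i)
    (hbdd : Bornology.IsBounded (polyhedron α ϖ fun _ => 1))
    (ha : 0 < maxValue (polyhedron α ϖ fun _ => 1)) {A N C₁₀ : ℝ}
    (hA : 0 ≤ A) (hN : ∀ i, A ≤ N * ϖ i) (hC₁₀ : s * A + s + 1 ≤ C₁₀)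
    (hface : FaceAssumption α ϖ N C₁₀) :
    ∃ C : ℝ, 0 ≤ C ∧ ∀ᶠ L : ℝ in Filter.atTop, ∀ T : Finset (Fin s → ℕ),
      (∀ n ∈ T, (fun i => (n i : ℝ)) ∈ polyhedron α ϖ (fun _ => L) ∧
        ∃ i, (n i : ℝ) ≤ A * Real.log L) →
      ∑ n ∈ T, Real.exp (∑ i, (n i : ℝ)) ≤
        C * (Real.log L ^ s * (L ^ maxFaceDim (polyhedron α ϖ fun _ => 1) / L *
          Real.exp (maxValue (polyhedron α ϖ fun _ => 1) * L))) := by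
  classical
  obtain ⟨C, hC, hfib⟩ := sum_exp_le_of_fiber hα hϖ hbdd hA hN hC₁₀
  set P := polyhedron α ϖ fun _ => 1
  set a := maxValue P
  set k := maxFaceDim P
  refine ⟨(A + 2) ^ s * (C + 1), by positivity, ?_⟩
  have hlog : ∀ᶠ L : ℝ in Filter.atTop, (s * A + 1) * Real.log L ≤ a * L := by
    have h1 : 0 < a / (s * A + 1) := by positivity
    filter_upwards [Real.isLittleO_log_id_atTop.def h1, Filter.eventually_ge_atTop 1] with L hL hL1
    rw [Real.norm_of_nonneg (Real.log_nonneg hL1), id, Real.norm_of_nonneg (by linarith),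
      div_mul_eq_mul_div, le_div_iff₀ (by positivity)] at hL
    linarith
  filter_upwards [hlog, Filter.eventually_ge_atTop (Real.exp 1),
    Real.tendsto_exp_atTop.eventually hface] with L hlogL hLe hfaceL T hT
  have hL1 : 1 ≤ L := (Real.one_le_exp zero_le_one).trans hLe
  have hL0 : 0 < L := by linarith
  have hl1 : 1 ≤ Real.log L := by rwa [Real.le_log_iff_exp_le hL0]
  set m := ⌊A * Real.log L⌋₊
  have hm : ∀ n : ℕ, (n : ℝ) ≤ A * Real.log L ↔ n ≤ m := fun n =>
    (Nat.le_floor_iff (by positivity)).symm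
  let g : (Fin s → ℕ) → Fin s → ℕ := fun n i => min (n i) (m + 1)
  let Y : Finset (Fin s → ℕ) := Fintype.piFinset fun _ => Finset.range (m + 2)
  have hmaps : ∀ n ∈ T, g n ∈ Y := by
    intro n _
    simp only [Y, g, Fintype.mem_piFinset, Finset.mem_range]
    intro i
    have := min_le_right (n i) (m + 1)
    omega
  set Φ := L ^ k / L * Real.exp (a * L)
  have hΦ : 0 ≤ Φ := by positivity
  have hY : (Y.card : ℝ) ≤ ((A + 2) * Real.log L) ^ s := by
    have h1 : Y.card = (m + 2) ^ s := by simp [Y]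
    rw [h1]
    push_cast
    have := Nat.floor_le (show 0 ≤ A * Real.log L by positivity)
    gcongr
    nlinarith
  have hz : ∀ z ∈ Y, ∑ n ∈ T with g n = z, Real.exp (∑ i, (n i : ℝ)) ≤ (C + 1) * Φ := by
    intro z _
    set J : Finset (Fin s) := Finset.univ.filter fun i => m < z i
    have hJ : ∀ i, i ∉ J ↔ z i ≤ m := fun i => by simp [J]
    have hnz : ∀ n ∈ T.filter fun n => g n = z, ∀ i ∉ J, n i = z i := by
      intro n hn i hi
      have h1 : min (n i) (m + 1) = z i := congrFun (Finset.mem_filter.1 hn).2 i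
      have h2 := (hJ i).1 hi
      omega
    rcases (T.filter fun n => g n = z).eq_empty_or_nonempty with h0 | ⟨n₀, hn₀⟩
    · rw [h0, Finset.sum_empty]; positivity
    have hJu : J ≠ Finset.univ := by
      obtain ⟨i, hi⟩ := (hT n₀ (Finset.mem_filter.1 hn₀).1).2
      rw [hm] at hi
      have h1 : min (n₀ i) (m + 1) = z i := congrFun (Finset.mem_filter.1 hn₀).2 i
      intro h
      have h2 : i ∈ J := h ▸ Finset.mem_univ i
      have h3 : m < z i := (Finset.mem_filter.1 h2).2
      omega
    rcases J.eq_empty_or_nonempty with hJe | hJne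
    · have h1 : T.filter (fun n => g n = z) ⊆ {z} := by
        intro n hn
        rw [Finset.mem_singleton]
        funext i
        exact hnz n hn i (by simp [hJe])
      calc ∑ n ∈ T with g n = z, Real.exp (∑ i, (n i : ℝ))
          ≤ ∑ n ∈ {z}, Real.exp (∑ i, (n i : ℝ)) :=
            Finset.sum_le_sum_of_subset_of_nonneg h1 fun _ _ _ => (Real.exp_pos _).le
        _ = Real.exp (∑ i, (z i : ℝ)) := Finset.sum_singleton _ _
        _ ≤ Real.exp (-Real.log L + a * L) := by
            rw [Real.exp_le_exp]
            have h2 : ∀ i ∈ Finset.univ, (z i : ℝ) ≤ A * Real.log L := fun i _ =>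
              (hm _).2 ((hJ i).1 (by simp [hJe]))
            have h3 := Finset.sum_le_card_nsmul _ _ _ h2
            simp only [Finset.card_univ, Fintype.card_fin, nsmul_eq_mul] at h3
            linarith
        _ = 1 / L * Real.exp (a * L) := by
            rw [Real.exp_add, Real.exp_neg, Real.exp_log hL0, one_div]
        _ ≤ L ^ k / L * Real.exp (a * L) := by
            gcongr
            exact one_le_pow₀ hL1
        _ ≤ (C + 1) * Φ := by nlinarith
    · refine (hfib J z L hL1 (fun i hi => (hm _).2 ((hJ i).1 hi)) ?_ _ fun n hn =>
        ⟨(hT n (Finset.mem_filter.1 hn).1).1, hnz n hn⟩).trans ?_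
      · intro y hy h
        have h1 := hfaceL J hJne hJu y
        simp only [Real.log_exp] at h1
        exact h1 hy h
      · change C * Φ ≤ _
        nlinarith
  calc ∑ n ∈ T, Real.exp (∑ i, (n i : ℝ))
      = ∑ z ∈ Y, ∑ n ∈ T with g n = z, Real.exp (∑ i, (n i : ℝ)) :=
        (Finset.sum_fiberwise_of_maps_to hmaps _).symm
    _ ≤ Y.card • ((C + 1) * Φ) := Finset.sum_le_card_nsmul _ _ _ hz
    _ ≤ ((A + 2) * Real.log L) ^ s * ((C + 1) * Φ) := by
        rw [nsmul_eq_mul]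
        gcongr
    _ = _ := by rw [mul_pow]; ring

end

/-! ### Comparison of measures by boxes -/

section Measures

variable {s : ℕ} {κ : Type*}

lemma mem_polyhedron_of_le {α : Fin s → κ → ℝ} {ϖ : Fin s → ℝ} {b b' : κ → ℝ}
    {u v : Fin s → ℝ} (hu : u ∈ polyhedron α ϖ b)
    (hv : ∀ i, 0 ≤ v i) (h : ∀ k, ∑ i, α i k * (ϖ i)⁻¹ * (v i - u i) ≤ b' k - b k) :
    v ∈ polyhedron α ϖ b' := by
  refine ⟨fun k => ?_, hv⟩
  have h1 := hu.1 k
  have h2 := h k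
  simp only [mul_sub, Finset.sum_sub_distrib] at h2
  linarith

lemma exists_polyhedron_box {α : Fin s → κ → ℝ} {ϖ : Fin s → ℝ}
    (hbdd : Bornology.IsBounded (polyhedron α ϖ fun _ => 1)) :
    ∃ R : ℝ, 0 ≤ R ∧ ∀ L : ℝ, 0 < L → ∀ u ∈ polyhedron α ϖ (fun _ => L), ∀ i, u i ≤ R * L := by
  obtain ⟨R, hR⟩ := hbdd.exists_norm_le
  refine ⟨R, (norm_nonneg _).trans (hR 0 (zero_mem_polyhedron_one α ϖ)), fun L hL u hu i => ?_⟩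
  have h1 := (smul_mem_polyhedron_iff α ϖ (fun _ => 1) hL (L⁻¹ • u)).1 (by
    rw [smul_smul, mul_inv_cancel₀ hL.ne', one_smul]; simpa using hu)
  have h2 := (norm_le_pi_norm _ i).trans (hR _ h1)
  have h3 : L⁻¹ * u i ≤ R := (le_abs_self _).trans h2
  rw [inv_mul_le_iff₀ hL] at h3
  linarith

lemma sum_le_of_mem_polyhedron {α : Fin s → κ → ℝ} {ϖ : Fin s → ℝ}
    (hbdd : Bornology.IsBounded (polyhedron α ϖ fun _ => 1)) {L : ℝ} (hL : 0 < L) {u : Fin s → ℝ}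
    (hu : u ∈ polyhedron α ϖ (fun _ => L)) :
    ∑ i, u i ≤ maxValue (polyhedron α ϖ fun _ => 1) * L := by
  have hcomp := Metric.isCompact_of_isClosed_isBounded (isClosed_polyhedron _ _ _) hbdd
  obtain ⟨-, -, -, hmax⟩ := exists_isMaxOn_of_isCompact hcomp ⟨0, zero_mem_polyhedron_one α ϖ⟩
  have h1 := hmax _ ((smul_mem_polyhedron_iff α ϖ (fun _ => 1) hL (L⁻¹ • u)).1 (by
    rw [smul_smul, mul_inv_cancel₀ hL.ne', one_smul]; simpa using hu))
  simp only [Pi.smul_apply, smul_eq_mul] at h1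
  rw [← Finset.mul_sum, inv_mul_le_iff₀ hL] at h1
  linarith

/-- A bound for the measures of the quadrants `Iic b` bounds the part of a dilated polytope near the
coordinate hyperplanes by an exponential sum over integer points. -/
lemma measureReal_small_coordinate_le {α : Fin s → κ → ℝ} (hα : ∀ i k, 0 ≤ α i k)
    {ϖ : Fin s → ℝ} (hϖ : ∀ i, 0 < ϖ i)
    (hbdd : Bornology.IsBounded (polyhedron α ϖ fun _ => 1)) {L τ X : ℝ} (hL : 0 < L)
    (hX : ∀ T : Finset (Fin s → ℕ),
      (∀ n ∈ T, (fun i => (n i : ℝ)) ∈ polyhedron α ϖ (fun _ => L) ∧ ∃ i, (n i : ℝ) ≤ τ) →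
      ∑ n ∈ T, Real.exp (∑ i, (n i : ℝ)) ≤ X)
    (μ : Measure (Fin s → ℝ)) (hfin : ∀ b, μ (Set.Iic b) ≠ ⊤) {W : ℝ} (hW : 0 ≤ W)
    (hμ : ∀ b, (∀ i, 0 ≤ b i) → μ.real (Set.Iic b) ≤ W * Real.exp (∑ i, b i)) :
    μ.real {u | u ∈ polyhedron α ϖ (fun _ => L) ∧ ∃ i, u i ≤ τ} ≤ W * Real.exp s * X := by
  classical
  obtain ⟨R, hR, hbox⟩ := exists_polyhedron_box hbdd
  set Q := polyhedron α ϖ fun _ => L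
  let T : Finset (Fin s → ℕ) := (Fintype.piFinset fun _ => Finset.range (⌊R * L⌋₊ + 1)).filter
    fun n => (fun i => (n i : ℝ)) ∈ Q ∧ ∃ i, (n i : ℝ) ≤ τ
  have hsub : {u | u ∈ Q ∧ ∃ i, u i ≤ τ} ⊆ ⋃ n ∈ T, Set.Iic fun i => (n i : ℝ) + 1 := by
    rintro u ⟨hu, i, hi⟩
    have hfl : ∀ i, (⌊u i⌋₊ : ℝ) ≤ u i := fun i => Nat.floor_le (hu.2 i)
    simp only [Set.mem_iUnion]
    refine ⟨fun i => ⌊u i⌋₊, ?_, fun i => (Nat.lt_floor_add_one (u i)).le⟩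
    simp only [T, Finset.mem_filter, Fintype.mem_piFinset, Finset.mem_range]
    refine ⟨fun j => ?_, mem_polyhedron_of_le hu (fun _ => by positivity) fun k => ?_,
      i, (hfl i).trans hi⟩
    · have := Nat.floor_le_floor (hbox L hL u hu j)
      omega
    · rw [sub_self]
      refine Finset.sum_nonpos fun i _ => mul_nonpos_of_nonneg_of_nonpos ?_ (by linarith [hfl i])
      exact mul_nonneg (hα i k) (inv_nonneg.2 (hϖ i).le)
  have hfinU : μ (⋃ n ∈ T, Set.Iic fun i => (n i : ℝ) + 1) ≠ ⊤ := by
    refine ne_top_of_le_ne_top ?_ (measure_biUnion_finset_le T _)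
    exact ENNReal.sum_ne_top.2 fun n _ => hfin _
  calc μ.real {u | u ∈ Q ∧ ∃ i, u i ≤ τ}
      ≤ μ.real (⋃ n ∈ T, Set.Iic fun i => (n i : ℝ) + 1) := measureReal_mono hsub hfinU
    _ ≤ ∑ n ∈ T, μ.real (Set.Iic fun i => (n i : ℝ) + 1) := measureReal_biUnion_finset_le _ _
    _ ≤ ∑ n ∈ T, W * Real.exp s * Real.exp (∑ i, (n i : ℝ)) := by
        refine Finset.sum_le_sum fun n _ => (hμ _ fun i => by positivity).trans_eq ?_
        rw [mul_assoc, ← Real.exp_add, Finset.sum_add_distrib]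
        congr 2
        simp [add_comm]
    _ ≤ W * Real.exp s * X := by
        rw [← Finset.mul_sum]
        gcongr
        exact hX T fun n hn => (Finset.mem_filter.1 hn).2

/-- Two measures that almost agree on quadrants almost agree on half-open boxes. -/
lemma abs_measureReal_box_sub_le (μ Λ : Measure (Fin s → ℝ)) (hμ : ∀ b, μ (Set.Iic b) ≠ ⊤)
    (hΛ : ∀ b, Λ (Set.Iic b) ≠ ⊤) {M K τ H : ℝ}
    (hK : ∀ b : Fin s → ℝ, (∀ i, τ ≤ b i) → ∑ i, b i ≤ H →
      |μ.real (Set.Iic b) - M * Λ.real (Set.Iic b)| ≤ K)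
    {x z : Fin s → ℝ} (hx : ∀ i, τ ≤ x i) (hxz : ∀ i, x i ≤ z i) (hz : ∑ i, z i ≤ H) :
    |μ.real {u | ∀ i, x i < u i ∧ u i ≤ z i} - M * Λ.real {u | ∀ i, x i < u i ∧ u i ≤ z i}| ≤
      2 ^ s * K := by
  classical
  let A : Finset (Fin s) → (Fin s → ℝ) → Set (Fin s → ℝ) := fun E z =>
    {u | (∀ i ∈ E, x i < u i) ∧ u ∈ Set.Iic z}
  have hAm : ∀ E z, MeasurableSet (A E z) := by
    intro E z
    have h : {u : Fin s → ℝ | ∀ i ∈ E, x i < u i} = ⋂ i ∈ E, {u | x i < u i} := by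
      ext u; simp
    refine MeasurableSet.inter (s₁ := {u : Fin s → ℝ | ∀ i ∈ E, x i < u i}) ?_ measurableSet_Iic
    rw [h]
    exact Finset.measurableSet_biInter _ fun i _ =>
      measurableSet_lt measurable_const (measurable_pi_apply i)
  -- The lower bounds of the box are introduced one coordinate after the other.
  have key : ∀ E : Finset (Fin s), ∀ z : Fin s → ℝ, (∀ i, τ ≤ z i) → ∑ i, z i ≤ H →
      (∀ i ∈ E, x i ≤ z i) → |μ.real (A E z) - M * Λ.real (A E z)| ≤ 2 ^ E.card * K := by
    intro E
    induction E using Finset.induction_on with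
    | empty =>
      intro z hz hH _
      have hA : A ∅ z = Set.Iic z := by ext u; simp [A]
      rw [hA, Finset.card_empty, pow_zero, one_mul]
      exact hK z hz hH
    | insert i E hi ih =>
      intro z hz hH hxz
      have hxi : x i ≤ z i := hxz i (Finset.mem_insert_self i E)
      have hle : Function.update z i (x i) ≤ z := by
        intro j
        by_cases h : j = i
        · subst h; simpa using hxi
        · simp [h]
      have hdiff : A (insert i E) z = A E z \ A E (Function.update z i (x i)) := by
        ext u
        constructor
        · rintro ⟨h1, h2⟩
          refine ⟨⟨fun j hj => h1 j (Finset.mem_insert_of_mem hj), h2⟩, fun h3 => ?_⟩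
          have h4 := h3.2 i
          rw [Function.update_self] at h4
          exact absurd (h1 i (Finset.mem_insert_self i E)) (not_lt.2 h4)
        · rintro ⟨⟨h1, h2⟩, h3⟩
          refine ⟨fun j hj => ?_, h2⟩
          rcases Finset.mem_insert.1 hj with rfl | hj
          · by_contra hcon
            refine h3 ⟨h1, fun l => ?_⟩
            by_cases h : l = j
            · subst h; rw [Function.update_self]; exact not_lt.1 hcon
            · rw [Function.update_of_ne h]; exact h2 l
          · exact h1 j hj
      have hsub : A E (Function.update z i (x i)) ⊆ A E z := fun u hu => ⟨hu.1, hu.2.trans hle⟩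
      have hfin : ∀ ρ : Measure (Fin s → ℝ), (∀ b, ρ (Set.Iic b) ≠ ⊤) → ∀ z, ρ (A E z) ≠ ⊤ :=
        fun ρ hρ z => ne_top_of_le_ne_top (hρ z) (measure_mono fun u hu => hu.2)
      have h1 := ih z hz hH fun j hj => hxz j (Finset.mem_insert_of_mem hj)
      have h2 := ih (Function.update z i (x i))
        (fun j => by
          by_cases h : j = i
          · subst h; simpa using hx j
          · simpa [h] using hz j)
        ((Finset.sum_le_sum fun j _ => hle j).trans hH)
        (fun j hj => by
          have h : j ≠ i := fun h => hi (h ▸ hj)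
          simpa [h] using hxz j (Finset.mem_insert_of_mem hj))
      rw [hdiff, measureReal_sdiff hsub (hAm _ _) (hfin μ hμ _),
        measureReal_sdiff hsub (hAm _ _) (hfin Λ hΛ _), Finset.card_insert_of_notMem hi, pow_succ]
      rw [abs_le] at h1 h2 ⊢
      constructor <;> linarith [h1.1, h1.2, h2.1, h2.2]
  have h := key Finset.univ z (fun i => (hx i).trans (hxz i)) hz fun i _ => hxz i
  have hA : A Finset.univ z = {u | ∀ i, x i < u i ∧ u i ≤ z i} := by
    ext u
    simp only [A, Set.mem_ofPred_eq, Finset.mem_univ, true_implies, Set.mem_Iic, Pi.le_def,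
      forall_and]
  rw [hA] at h
  simpa using h

/-- Comparison of two measures on a dilated polytope, away from the coordinate hyperplanes, by means
of a grid of boxes of side length `θ`. -/
lemma measureReal_polyhedron_compare {α : Fin s → κ → ℝ} (hα : ∀ i k, 0 ≤ α i k)
    {ϖ : Fin s → ℝ} (hϖ : ∀ i, 0 < ϖ i)
    (hbdd : Bornology.IsBounded (polyhedron α ϖ fun _ => 1)) {R c₀ L θ τ M K : ℝ} (hL : 0 < L)
    (hR : 0 ≤ R) (hbox : ∀ L : ℝ, 0 < L → ∀ u ∈ polyhedron α ϖ (fun _ => L), ∀ i, u i ≤ R * L)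
    (hc₀ : ∀ k, ∑ i, α i k * (ϖ i)⁻¹ ≤ c₀) (hc₀L : 0 < L + c₀ * θ) (hθ : 0 < θ) (hτ : 0 ≤ τ)
    (hM : 0 ≤ M) (hK0 : 0 ≤ K)
    (μ Λ : Measure (Fin s → ℝ)) (hμ : ∀ b, μ (Set.Iic b) ≠ ⊤) (hΛ : ∀ b, Λ (Set.Iic b) ≠ ⊤)
    (hK : ∀ b : Fin s → ℝ, (∀ i, τ ≤ b i) →
      ∑ i, b i ≤ maxValue (polyhedron α ϖ fun _ => 1) * L + s * θ →
      |μ.real (Set.Iic b) - M * Λ.real (Set.Iic b)| ≤ K) :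
    μ.real {u | u ∈ polyhedron α ϖ (fun _ => L) ∧ ∀ i, τ < u i} ≤
        M * Λ.real (polyhedron α ϖ fun _ => L + c₀ * θ) + (R * L / θ + 1) ^ s * (2 ^ s * K) ∧
      M * Λ.real {u | u ∈ polyhedron α ϖ (fun _ => L - c₀ * θ) ∧ ∀ i, τ < u i} ≤
        μ.real (polyhedron α ϖ fun _ => L) + (R * L / θ + 1) ^ s * (2 ^ s * K) := by
  classical
  let Q : ℝ → Set (Fin s → ℝ) := fun L => polyhedron α ϖ fun _ => L
  let x : (Fin s → ℕ) → Fin s → ℝ := fun m i => τ + θ * m i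
  let z : (Fin s → ℕ) → Fin s → ℝ := fun m i => x m i + θ
  let box : (Fin s → ℕ) → Set (Fin s → ℝ) := fun m => {u | ∀ i, x m i < u i ∧ u i ≤ z m i}
  have hx : ∀ m i, τ ≤ x m i := fun m i => by
    have : 0 ≤ θ * m i := by positivity
    simp only [x]; linarith
  have hxz : ∀ m i, x m i ≤ z m i := fun m i => by simp only [z]; linarith
  have hcoef : ∀ i k, 0 ≤ α i k * (ϖ i)⁻¹ := fun i k =>
    mul_nonneg (hα i k) (inv_nonneg.2 (hϖ i).le)
  -- Moving a point down stays in the polytope.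
  -- Moving it up by at most `θ` enlarges `L` by `c₀ * θ`.
  have hdown : ∀ {L u v}, u ∈ Q L → (∀ i, 0 ≤ v i) → (∀ i, v i ≤ u i) → v ∈ Q L :=
    fun hu hv h => mem_polyhedron_of_le hu hv fun k => by
      rw [sub_self]
      exact Finset.sum_nonpos fun i _ =>
        mul_nonpos_of_nonneg_of_nonpos (hcoef i k) (by linarith [h i])
  have hup : ∀ {L L' u v}, u ∈ Q L → (∀ i, 0 ≤ v i) → (∀ i, v i ≤ u i + θ) → L + c₀ * θ = L' →
      v ∈ Q L' := fun {L L' u v} hu hv h hL' => mem_polyhedron_of_le hu hv fun k => by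
    calc ∑ i, α i k * (ϖ i)⁻¹ * (v i - u i) ≤ ∑ i, α i k * (ϖ i)⁻¹ * θ :=
          Finset.sum_le_sum fun i _ =>
            mul_le_mul_of_nonneg_left (by linarith [h i]) (hcoef i k)
      _ = (∑ i, α i k * (ϖ i)⁻¹) * θ := (Finset.sum_mul _ _ _).symm
      _ ≤ c₀ * θ := by gcongr; exact hc₀ k
      _ = L' - L := by linarith
  let Y : Finset (Fin s → ℕ) := Fintype.piFinset fun _ => Finset.range (⌊R * L / θ⌋₊ + 1)
  let S : Finset (Fin s → ℕ) := Y.filter fun m => x m ∈ Q L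
  let S' : Finset (Fin s → ℕ) := Y.filter fun m => z m ∈ Q L
  have hY : ∀ m, x m ∈ Q L → m ∈ Y := by
    intro m hm
    simp only [Y, Fintype.mem_piFinset, Finset.mem_range]
    intro i
    have h1 : τ + θ * m i ≤ R * L := hbox L hL _ hm i
    have h2 : (m i : ℝ) ≤ R * L / θ := by rw [le_div_iff₀ hθ]; linarith
    have := Nat.le_floor h2
    omega
  have hxpos : ∀ m i, 0 ≤ x m i := fun m i => hτ.trans (hx m i)
  have hz_x : ∀ m, z m ∈ Q L → x m ∈ Q L := fun m hm => hdown hm (hxpos m) (hxz m)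
  have hcard : ∀ T ⊆ Y, (T.card : ℝ) ≤ (R * L / θ + 1) ^ s := by
    intro T hT
    have h1 : (T.card : ℝ) ≤ Y.card := by exact_mod_cast Finset.card_le_card hT
    have h2 : Y.card = (⌊R * L / θ⌋₊ + 1) ^ s := by simp [Y]
    refine h1.trans ?_
    rw [h2]
    push_cast
    gcongr
    exact Nat.floor_le (by positivity)
  have hdisj : ∀ T : Finset (Fin s → ℕ), (T : Set (Fin s → ℕ)).PairwiseDisjoint box := by
    intro T m _ m' _ hne
    refine Set.disjoint_left.2 fun u hu hu' => hne (funext fun i => ?_)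
    have h1 := hu i
    have h2 := hu' i
    simp only [x, z] at h1 h2
    have h3 : θ * (m i : ℝ) < θ * (m' i + 1) := by linarith
    have h4 : θ * (m' i : ℝ) < θ * (m i + 1) := by linarith
    have h5 : m i < m' i + 1 := by exact_mod_cast lt_of_mul_lt_mul_left h3 hθ.le
    have h6 : m' i < m i + 1 := by exact_mod_cast lt_of_mul_lt_mul_left h4 hθ.le
    omega
  have hboxm : ∀ m, MeasurableSet (box m) := by
    intro m
    simp only [box, Set.ofPred_forall]
    exact MeasurableSet.iInter fun i => (measurableSet_lt measurable_const
      (measurable_pi_apply i)).inter (measurableSet_le (measurable_pi_apply i) measurable_const)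
  have hcover : ∀ u : Fin s → ℝ, (∀ i, τ < u i) → ∃ m, u ∈ box m := by
    intro u hu
    have hex : ∀ i, ∃ m : ℕ, τ + θ * m < u i ∧ u i ≤ τ + θ * m + θ := by
      intro i
      have hpos : 0 < (u i - τ) / θ := div_pos (by linarith [hu i]) hθ
      have h0 : 0 < ⌈(u i - τ) / θ⌉₊ := Nat.ceil_pos.2 hpos
      obtain ⟨m, hm⟩ : ∃ m, ⌈(u i - τ) / θ⌉₊ = m + 1 := ⟨_, (Nat.succ_pred_eq_of_pos h0).symm⟩
      have h1 := Nat.le_ceil ((u i - τ) / θ)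
      have h2 := Nat.ceil_lt_add_one hpos.le
      rw [hm] at h1 h2
      push_cast at h1 h2
      have h3 : (m : ℝ) < (u i - τ) / θ := by linarith
      rw [div_le_iff₀ hθ] at h1
      rw [lt_div_iff₀ hθ] at h3
      exact ⟨m, by linarith, by linarith⟩
    choose m hm using hex
    exact ⟨m, hm⟩
  have hfinQ : ∀ (ρ : Measure (Fin s → ℝ)), (∀ b, ρ (Set.Iic b) ≠ ⊤) → ∀ L, 0 < L → ρ (Q L) ≠ ⊤ :=
    fun ρ hρ L hL => ne_top_of_le_ne_top (hρ fun _ => R * L) (measure_mono fun u hu i =>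
      hbox L hL u hu i)
  have hfinB : ∀ (ρ : Measure (Fin s → ℝ)), (∀ b, ρ (Set.Iic b) ≠ ⊤) → ∀ m, ρ (box m) ≠ ⊤ :=
    fun ρ hρ m => ne_top_of_le_ne_top (hρ (z m)) (measure_mono fun u hu i => (hu i).2)
  have hfinU : ∀ (ρ : Measure (Fin s → ℝ)), (∀ b, ρ (Set.Iic b) ≠ ⊤) → ∀ T : Finset (Fin s → ℕ),
      ρ (⋃ m ∈ T, box m) ≠ ⊤ := fun ρ hρ T =>
    ne_top_of_le_ne_top (ENNReal.sum_ne_top.2 fun m _ => hfinB ρ hρ m)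
      (measure_biUnion_finset_le T _)
  have hsum : ∀ (ρ : Measure (Fin s → ℝ)), (∀ b, ρ (Set.Iic b) ≠ ⊤) → ∀ T : Finset (Fin s → ℕ),
      ρ.real (⋃ m ∈ T, box m) = ∑ m ∈ T, ρ.real (box m) := fun ρ hρ T =>
    measureReal_biUnion_finset (hdisj T) (fun m _ => hboxm m) (fun m _ => hfinB ρ hρ m)
  have hdiff : ∀ T ⊆ S, |μ.real (⋃ m ∈ T, box m) - M * Λ.real (⋃ m ∈ T, box m)| ≤
      (R * L / θ + 1) ^ s * (2 ^ s * K) := by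
    intro T hT
    rw [hsum μ hμ, hsum Λ hΛ, Finset.mul_sum, ← Finset.sum_sub_distrib]
    refine (Finset.abs_sum_le_sum_abs _ _).trans ?_
    have h1 : ∀ m ∈ T, |μ.real (box m) - M * Λ.real (box m)| ≤ 2 ^ s * K := by
      intro m hm
      refine abs_measureReal_box_sub_le μ Λ hμ hΛ hK (hx m) (hxz m) ?_
      have h2 := sum_le_of_mem_polyhedron hbdd hL (Finset.mem_filter.1 (hT hm)).2
      simp only [z, Finset.sum_add_distrib, Finset.sum_const, Finset.card_univ, Fintype.card_fin,
        nsmul_eq_mul]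
      linarith
    refine (Finset.sum_le_card_nsmul _ _ _ h1).trans ?_
    rw [nsmul_eq_mul]
    gcongr
    exact hcard T (hT.trans (Finset.filter_subset _ _))
  constructor
  · have h1 : {u | u ∈ Q L ∧ ∀ i, τ < u i} ⊆ ⋃ m ∈ S, box m := by
      rintro u ⟨hu, hτu⟩
      obtain ⟨m, hm⟩ := hcover u hτu
      have hxm : x m ∈ Q L := hdown hu (hxpos m) fun i => (hm i).1.le
      simp only [Set.mem_iUnion]
      exact ⟨m, Finset.mem_filter.2 ⟨hY m hxm, hxm⟩, hm⟩
    have h2 : ⋃ m ∈ S, box m ⊆ Q (L + c₀ * θ) := by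
      intro u hu
      simp only [Set.mem_iUnion] at hu
      obtain ⟨m, hm, hum⟩ := hu
      exact hup (Finset.mem_filter.1 hm).2 (fun i => (hxpos m i).trans (hum i).1.le)
        (fun i => (hum i).2) rfl
    have h3 := measureReal_mono h1 (hfinU μ hμ S)
    have h4 := mul_le_mul_of_nonneg_left (measureReal_mono h2 (hfinQ Λ hΛ _ hc₀L)) hM
    have h5 := (abs_le.1 (hdiff S subset_rfl)).2
    change μ.real {u | u ∈ Q L ∧ ∀ i, τ < u i} ≤ M * Λ.real (Q (L + c₀ * θ)) + _
    linarith
  · have hS' : S' ⊆ S := fun m hm => by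
      obtain ⟨h1, h2⟩ := Finset.mem_filter.1 hm
      exact Finset.mem_filter.2 ⟨h1, hz_x m h2⟩
    have h1 : {u | u ∈ Q (L - c₀ * θ) ∧ ∀ i, τ < u i} ⊆ ⋃ m ∈ S', box m := by
      rintro u ⟨hu, hτu⟩
      obtain ⟨m, hm⟩ := hcover u hτu
      have hzm : z m ∈ Q L := hup hu (fun i => (hxpos m i).trans (hxz m i))
        (fun i => by simp only [z]; linarith [(hm i).1]) (by ring)
      simp only [Set.mem_iUnion]
      exact ⟨m, Finset.mem_filter.2 ⟨hY m (hz_x m hzm), hzm⟩, hm⟩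
    have h2 : ⋃ m ∈ S', box m ⊆ Q L := by
      intro u hu
      simp only [Set.mem_iUnion] at hu
      obtain ⟨m, hm, hum⟩ := hu
      exact hdown (Finset.mem_filter.1 hm).2 (fun i => (hxpos m i).trans (hum i).1.le)
        (fun i => (hum i).2)
    have h3 := measureReal_mono h2 (hfinQ μ hμ L hL)
    have h4 := mul_le_mul_of_nonneg_left (measureReal_mono h1 (hfinU Λ hΛ S')) hM
    have h5 := (abs_le.1 (hdiff S' hS')).1
    change M * Λ.real {u | u ∈ Q (L - c₀ * θ) ∧ ∀ i, τ < u i} ≤ μ.real (Q L) + _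
    linarith

end Measures

/-! ### Asymptotics for measures with a distribution function close to an exponential -/

section

/-- A function with leading term `L ^ k * exp (a * L)` does not feel a shift of the argument
by `O(1 / L)`. -/
lemma exists_shift_bound {V : ℝ → ℝ} {F C a : ℝ} {k : ℕ}
    (h : ∀ L, 0 < L → |V L - F * (L ^ k * Real.exp (a * L))| ≤ C * (L ^ k / L * Real.exp (a * L)))
    (c₁ : ℝ) : ∃ C' : ℝ, 0 ≤ C' ∧ ∀ᶠ L : ℝ in Filter.atTop,
      |V (L + c₁ * (1 / L)) - F * (L ^ k * Real.exp (a * L))| ≤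
        C' * (L ^ k / L * Real.exp (a * L)) := by
  let g : ℝ → ℝ := fun x => (1 + c₁ * x ^ 2) ^ k * Real.exp (a * c₁ * x)
  have hg : DifferentiableAt ℝ g 0 := by fun_prop
  have hO := hg.hasDerivAt.isBigO_sub
  obtain ⟨K, hK, hO⟩ := hO.exists_pos
  have hO' := (tendsto_inv_atTop_zero (𝕜 := ℝ)).eventually hO.bound
  have hg0 : g 0 = 1 := by simp [g]
  refine ⟨|C| * ((1 + K) * 2) + |F| * K, by positivity, ?_⟩
  filter_upwards [hO', Filter.eventually_ge_atTop 1,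
    Filter.eventually_ge_atTop (2 * |c₁|)] with L hL hL1 hLc
  have hL0 : 0 < L := by linarith
  simp only [hg0, sub_zero, Real.norm_eq_abs, abs_of_pos (inv_pos.2 hL0)] at hL
  have hinv : L⁻¹ ≤ 1 := inv_le_one_of_one_le₀ hL1
  have hL' : L / 2 ≤ L + c₁ * (1 / L) := by
    have h1 : |c₁ * (1 / L)| ≤ L / 2 := by
      rw [abs_mul, one_div, abs_of_pos (inv_pos.2 hL0)]
      calc |c₁| * L⁻¹ ≤ |c₁| * 1 := by gcongr
        _ ≤ L / 2 := by linarith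
    linarith [(abs_le.1 h1).1]
  set L' := L + c₁ * (1 / L) with hL'def
  have hL'0 : 0 < L' := by linarith
  have hΨ : L' ^ k * Real.exp (a * L') = L ^ k * Real.exp (a * L) * g L⁻¹ := by
    have h1 : L' = L * (1 + c₁ * L⁻¹ ^ 2) := by rw [hL'def]; field_simp
    have h2 : a * L' = a * L + a * c₁ * L⁻¹ := by rw [hL'def]; field_simp
    rw [h2, Real.exp_add, h1, mul_pow]
    ring
  set Ψ := L ^ k * Real.exp (a * L)
  have hΨ0 : 0 < Ψ := by positivity
  have hΦ : L ^ k / L * Real.exp (a * L) = Ψ * L⁻¹ := by simp only [Ψ]; ring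
  have hΦ' : L' ^ k / L' * Real.exp (a * L') = Ψ * g L⁻¹ * L'⁻¹ := by rw [← hΨ]; ring
  have h1 := h L' hL'0
  rw [hΨ, hΦ'] at h1
  rw [hΦ]
  have hg1 : g L⁻¹ ≤ 1 + K := by
    have := (abs_le.1 hL).2
    nlinarith
  have hgpos : 0 ≤ g L⁻¹ := by
    have h3 : 0 < Ψ * g L⁻¹ := by rw [← hΨ]; positivity
    exact (pos_of_mul_pos_right h3 hΨ0.le).le
  have hinv' : L'⁻¹ ≤ 2 * L⁻¹ := by
    have h3 : (L / 2)⁻¹ = 2 * L⁻¹ := by field_simp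
    rw [← h3]
    gcongr
  have h2 : |F * (Ψ * g L⁻¹) - F * Ψ| ≤ |F| * K * (Ψ * L⁻¹) := by
    have h3 : F * (Ψ * g L⁻¹) - F * Ψ = F * (Ψ * (g L⁻¹ - 1)) := by ring
    rw [h3, abs_mul, abs_mul, abs_of_pos hΨ0]
    calc |F| * (Ψ * |g L⁻¹ - 1|) ≤ |F| * (Ψ * (K * L⁻¹)) := by gcongr
      _ = _ := by ring
  calc |V L' - F * Ψ| ≤ |V L' - F * (Ψ * g L⁻¹)| + |F * (Ψ * g L⁻¹) - F * Ψ| :=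
        abs_sub_le _ _ _
    _ ≤ |C| * (Ψ * (1 + K) * (2 * L⁻¹)) + |F| * K * (Ψ * L⁻¹) := by
        refine add_le_add (h1.trans ?_) h2
        have h4 : 0 ≤ Ψ * g L⁻¹ * L'⁻¹ := by positivity
        refine (mul_le_mul_of_nonneg_right (le_abs_self C) h4).trans ?_
        gcongr
    _ = _ := by ring

variable {s : ℕ} {κ : Type*} [Fintype κ]

/-- The hyperbola method for a measure `μ` on `ℝ^s` whose distribution function is close to
`M * exp (∑ i, b i)` when all `b i` are large. -/
theorem exists_measureReal_polyhedron_asymptotic {α : Fin s → κ → ℝ} (hα : ∀ i k, 0 ≤ α i k)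
    {ϖ : Fin s → ℝ} (hϖ : ∀ i, 0 < ϖ i)
    (hbdd : Bornology.IsBounded (polyhedron α ϖ fun _ => 1))
    (ha : 0 < maxValue (polyhedron α ϖ fun _ => 1)) {A N C₁₀ Δ c F C₀ : ℝ}
    (hA : 0 ≤ A) (hN : ∀ i, A ≤ N * ϖ i) (hC₁₀ : s * A + s + 1 ≤ C₁₀)
    (hface : FaceAssumption α ϖ N C₁₀) (hΔ : 2 * s + 1 ≤ Δ * A) (hc : 0 ≤ c)
    (hV : ∀ L, 0 < L → |(expMeasure (Fin s)).real (polyhedron α ϖ fun _ => L) -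
        F * (L ^ maxFaceDim (polyhedron α ϖ fun _ => 1) *
          Real.exp (maxValue (polyhedron α ϖ fun _ => 1) * L))| ≤
      C₀ * (L ^ maxFaceDim (polyhedron α ϖ fun _ => 1) / L *
          Real.exp (maxValue (polyhedron α ϖ fun _ => 1) * L))) :
    ∃ C : ℝ, ∀ᶠ L : ℝ in Filter.atTop, ∀ (μ : Measure (Fin s → ℝ)) (M E : ℝ), 0 ≤ M → M ≤ E →
      (∀ b, μ (Set.Iic b) ≠ ⊤) →
      (∀ (β : ℝ) (b : Fin s → ℝ), 0 ≤ β → (∀ i, β ≤ b i) →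
        |μ.real (Set.Iic b) - M * Real.exp (∑ i, b i)| ≤
          c * (E * Real.exp (∑ i, b i) * Real.exp (-(Δ * β)))) →
      |μ.real (polyhedron α ϖ fun _ => L) -
          M * F * (L ^ maxFaceDim (polyhedron α ϖ fun _ => 1) *
            Real.exp (maxValue (polyhedron α ϖ fun _ => 1) * L))| ≤
        C * (E * Real.log L ^ s * (L ^ maxFaceDim (polyhedron α ϖ fun _ => 1) / L *
          Real.exp (maxValue (polyhedron α ϖ fun _ => 1) * L))) := by
  obtain ⟨R, hR, hbox⟩ := exists_polyhedron_box hbdd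
  obtain ⟨C₁, hC₁, hsmall⟩ :=
    exists_sum_exp_small_coordinate_le hα hϖ hbdd ha hA hN hC₁₀ hface
  obtain ⟨c₀, hc₀0, hc₀⟩ : ∃ c₀ : ℝ, 0 ≤ c₀ ∧ ∀ k, ∑ i, α i k * (ϖ i)⁻¹ ≤ c₀ := by
    have h0 : ∀ k, 0 ≤ ∑ i, α i k * (ϖ i)⁻¹ := fun k => Finset.sum_nonneg fun i _ =>
      mul_nonneg (hα i k) (inv_nonneg.2 (hϖ i).le)
    exact ⟨∑ k, ∑ i, α i k * (ϖ i)⁻¹, Finset.sum_nonneg fun k _ => h0 k, fun k =>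
      Finset.single_le_sum (fun k _ => h0 k) (Finset.mem_univ k)⟩
  obtain ⟨C₂, hC₂, hup⟩ := exists_shift_bound hV c₀
  obtain ⟨C₃, hC₃, hlow⟩ := exists_shift_bound hV (-c₀)
  set P := polyhedron α ϖ fun _ => 1
  set a := maxValue P
  set k := maxFaceDim P
  set C₄ : ℝ := (R + 1) ^ s * (2 ^ s * (c * Real.exp s))
  have hC₄ : 0 ≤ C₄ := by positivity
  refine ⟨C₂ + C₃ + C₄ + (1 + c) * Real.exp s * C₁ + Real.exp s * C₁, ?_⟩
  filter_upwards [hsmall, hup, hlow, Filter.eventually_ge_atTop (Real.exp 1),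
    Filter.eventually_ge_atTop (c₀ + 1)] with L hsmallL hupL hlowL hLe hLc μ M E hM hME hfin hμ
  have hL1 : 1 ≤ L := (Real.one_le_exp zero_le_one).trans hLe
  have hL0 : 0 < L := by linarith
  have hl1 : 1 ≤ Real.log L := by rwa [Real.le_log_iff_exp_le hL0]
  have hE : 0 ≤ E := hM.trans hME
  set τ := A * Real.log L
  have hτ : 0 ≤ τ := by positivity
  set Ψ := L ^ k * Real.exp (a * L)
  set Φ := L ^ k / L * Real.exp (a * L)
  have hΦ : 0 < Φ := by positivity
  set Λ := expMeasure (Fin s)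
  have hΛfin : ∀ b, Λ (Set.Iic b) ≠ ⊤ := fun b => by
    rw [expMeasure_Iic]; exact ENNReal.ofReal_ne_top
  have hΛ : ∀ b, Λ.real (Set.Iic b) = Real.exp (∑ i, b i) := fun b => by
    rw [Measure.real, expMeasure_Iic, ENNReal.toReal_ofReal (Real.exp_pos _).le]
  let Q : ℝ → Set (Fin s → ℝ) := fun L => polyhedron α ϖ fun _ => L
  set X := C₁ * (Real.log L ^ s * Φ)
  have hX : 0 ≤ X := by positivity
  have hμsmall : μ.real {u | u ∈ Q L ∧ ∃ i, u i ≤ τ} ≤ (1 + c) * E * Real.exp s * X := by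
    refine measureReal_small_coordinate_le hα hϖ hbdd hL0 hsmallL μ hfin (by positivity)
      fun b hb => ?_
    have h1 := (abs_le.1 (hμ 0 b le_rfl hb)).2
    rw [mul_zero, neg_zero, Real.exp_zero, mul_one] at h1
    have h2 : M * Real.exp (∑ i, b i) ≤ E * Real.exp (∑ i, b i) := by gcongr
    linarith
  have hΛsmall : Λ.real {u | u ∈ Q L ∧ ∃ i, u i ≤ τ} ≤ 1 * Real.exp s * X :=
    measureReal_small_coordinate_le hα hϖ hbdd hL0 hsmallL Λ hΛfin zero_le_one
      fun b _ => by rw [hΛ, one_mul]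
  -- The total error of the comparison on the grid of boxes of side length `1 / L`.
  set K : ℝ := c * (E * Real.exp (a * L + s) * Real.exp (-(Δ * τ)))
  have hK : ∀ b : Fin s → ℝ, (∀ i, τ ≤ b i) → ∑ i, b i ≤ a * L + s * (1 / L) →
      |μ.real (Set.Iic b) - M * Λ.real (Set.Iic b)| ≤ K := by
    intro b hb hsum
    rw [hΛ]
    refine (hμ τ b hτ hb).trans ?_
    have h1 : ∑ i, b i ≤ a * L + s := by
      refine hsum.trans ?_
      have h2 : 1 / L ≤ 1 := by rw [div_le_one hL0]; exact hL1
      have h3 : (s : ℝ) * (1 / L) ≤ s * 1 := by gcongr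
      linarith
    simp only [K]
    gcongr
  have herr : (R * L / (1 / L) + 1) ^ s * (2 ^ s * K) ≤ C₄ * (E * Φ) := by
    have h1 : R * L / (1 / L) + 1 ≤ (R + 1) * L ^ 2 := by
      have h3 : R * L / (1 / L) = R * L ^ 2 := by field_simp
      rw [h3]
      nlinarith [one_le_pow₀ hL1 (n := 2)]
    have h2 : Real.exp (-(Δ * τ)) ≤ (L ^ (2 * s))⁻¹ * L⁻¹ := by
      have h3 : (L ^ (2 * s))⁻¹ * L⁻¹ = Real.exp (-((2 * s + 1) * Real.log L)) := by
        rw [Real.exp_neg, ← mul_inv, ← pow_succ, mul_comm _ (Real.log L),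
          ← Real.rpow_def_of_pos hL0, ← Real.rpow_natCast]
        push_cast
        rfl
      rw [h3, Real.exp_le_exp, neg_le_neg_iff]
      have := mul_le_mul_of_nonneg_right hΔ (zero_le_one.trans hl1)
      simp only [τ]
      linarith
    have h4 : L⁻¹ ≤ L ^ k / L := by
      rw [inv_eq_one_div]
      gcongr
      exact one_le_pow₀ hL1
    calc (R * L / (1 / L) + 1) ^ s * (2 ^ s * K)
        ≤ ((R + 1) * L ^ 2) ^ s * (2 ^ s *
            (c * (E * Real.exp (a * L + s) * ((L ^ (2 * s))⁻¹ * L⁻¹)))) := by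
          simp only [K]
          gcongr
      _ = C₄ * (E * (L⁻¹ * Real.exp (a * L))) := by
          rw [Real.exp_add, mul_pow, ← pow_mul]
          simp only [C₄]
          field_simp
      _ ≤ C₄ * (E * Φ) := by
          simp only [Φ]
          gcongr
  have hc₀L : c₀ * (1 / L) < L := by
    have h2 : 1 / L ≤ 1 := by rw [div_le_one hL0]; exact hL1
    have h3 : c₀ * (1 / L) ≤ c₀ * 1 := by gcongr
    linarith
  have hc₀L' : 0 ≤ c₀ * (1 / L) := by positivity
  obtain ⟨h1, h2⟩ := measureReal_polyhedron_compare hα hϖ hbdd hL0 hR hbox hc₀ (by linarith)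
    (by positivity : 0 < 1 / L) hτ hM (by positivity : 0 ≤ K) μ Λ hfin hΛfin hK
  have hfinQ : ∀ (ρ : Measure (Fin s → ℝ)), (∀ b, ρ (Set.Iic b) ≠ ⊤) → ∀ L, 0 < L → ρ (Q L) ≠ ⊤ :=
    fun ρ hρ L hL => ne_top_of_le_ne_top (hρ fun _ => R * L) (measure_mono fun u hu i =>
      hbox L hL u hu i)
  have hsplit : ∀ (ρ : Measure (Fin s → ℝ)) (Q' : Set (Fin s → ℝ)),
      ρ.real Q' ≤ ρ.real {u | u ∈ Q' ∧ ∃ i, u i ≤ τ} + ρ.real {u | u ∈ Q' ∧ ∀ i, τ < u i} := by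
    intro ρ Q'
    refine le_trans (le_of_eq ?_) (measureReal_union_le _ _)
    congr 1
    ext u
    constructor
    · intro hu
      by_cases h : ∃ i, u i ≤ τ
      · exact Or.inl ⟨hu, h⟩
      · push Not at h
        exact Or.inr ⟨hu, h⟩
    · rintro (h | h) <;> exact h.1
  have hμQ := hsplit μ (Q L)
  have hΛQ := hsplit Λ (Q (L - c₀ * (1 / L)))
  have hΛmono : Λ.real {u | u ∈ Q (L - c₀ * (1 / L)) ∧ ∃ i, u i ≤ τ} ≤
      Λ.real {u | u ∈ Q L ∧ ∃ i, u i ≤ τ} := by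
    refine measureReal_mono ?_ (ne_top_of_le_ne_top (hfinQ Λ hΛfin L hL0)
      (measure_mono fun u hu => hu.1))
    rintro u ⟨hu, hi⟩
    exact ⟨⟨fun k => (hu.1 k).trans (by linarith), hu.2⟩, hi⟩
  have hlow' : L + -c₀ * (1 / L) = L - c₀ * (1 / L) := by ring
  rw [hlow'] at hlowL
  have hlog1 : 1 ≤ Real.log L ^ s := one_le_pow₀ hl1
  set Y := E * Real.log L ^ s * Φ with hY
  have hEΦ : E * Φ ≤ Y := by
    simp only [Y, mul_assoc]
    gcongr
    nlinarith
  have hMΦ : M * Φ ≤ E * Φ := by gcongr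
  have hEX : E * X = C₁ * Y := by simp only [X, Y]; ring
  have hMX : M * X ≤ E * X := by gcongr
  have h3 := mul_le_mul_of_nonneg_left (abs_le.1 hupL).2 hM
  have h4 := mul_le_mul_of_nonneg_left (abs_le.1 hlowL).1 hM
  have h5 := mul_le_mul_of_nonneg_left hΛQ hM
  have h6 := mul_le_mul_of_nonneg_left (hΛmono.trans hΛsmall) hM
  have hup2 : M * (C₂ * Φ) ≤ C₂ * Y := by
    calc M * (C₂ * Φ) = C₂ * (M * Φ) := by ring
      _ ≤ C₂ * Y := by gcongr; exact hMΦ.trans hEΦ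
  have hlow2 : M * (C₃ * Φ) ≤ C₃ * Y := by
    calc M * (C₃ * Φ) = C₃ * (M * Φ) := by ring
      _ ≤ C₃ * Y := by gcongr; exact hMΦ.trans hEΦ
  have herr2 : C₄ * (E * Φ) ≤ C₄ * Y := by gcongr
  have hs1 : (1 + c) * E * Real.exp s * X = (1 + c) * Real.exp s * C₁ * Y := by
    calc _ = (1 + c) * Real.exp s * (E * X) := by ring
      _ = _ := by rw [hEX]; ring
  have hs2 : M * (1 * Real.exp s * X) ≤ Real.exp s * C₁ * Y := by
    calc M * (1 * Real.exp s * X) = Real.exp s * (M * X) := by ring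
      _ ≤ Real.exp s * (E * X) := by gcongr
      _ = _ := by rw [hEX]; ring
  have hY0 : 0 ≤ Y := by positivity
  have hp2 : 0 ≤ C₂ * Y := by positivity
  have hp3 : 0 ≤ C₃ * Y := by positivity
  have hp4 : 0 ≤ C₄ * Y := by positivity
  have hp5 : 0 ≤ (1 + c) * Real.exp s * C₁ * Y := by positivity
  have hp6 : 0 ≤ Real.exp s * C₁ * Y := by positivity
  change |μ.real (Q L) - M * F * Ψ| ≤ _
  change μ.real {u | u ∈ Q L ∧ ∀ i, τ < u i} ≤ M * Λ.real (Q (L + c₀ * (1 / L))) + _ at h1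
  change M * Λ.real {u | u ∈ Q (L - c₀ * (1 / L)) ∧ ∀ i, τ < u i} ≤ μ.real (Q L) + _ at h2
  change _ ≤ M * (Λ.real (Q (L - c₀ * (1 / L))) - F * Ψ) at h4
  change M * (Λ.real (Q (L + c₀ * (1 / L))) - F * Ψ) ≤ _ at h3
  rw [abs_le]
  constructor <;> linarith

end

/-! ### Arithmetic functions as measures in logarithmic coordinates -/

section PointMeasure

variable {s : ℕ} {κ : Type*}

/-- The logarithmic coordinates `ϖ i * log (y i)` of a vector of positive integers. -/
noncomputable def logPoint (ϖ : Fin s → ℝ) (y : Fin s → ℕ+) : Fin s → ℝ :=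
  fun i => ϖ i * Real.log (y i : ℕ)

/-- The measure that gives mass `f y` to the point `logPoint ϖ y`, for all `y`. -/
noncomputable def pointMeasure (ϖ : Fin s → ℝ) (f : (Fin s → ℕ+) → ℝ) : Measure (Fin s → ℝ) :=
  Measure.sum fun y => ENNReal.ofReal (f y) • Measure.dirac (logPoint ϖ y)

lemma pointMeasure_apply (ϖ : Fin s → ℝ) {f : (Fin s → ℕ+) → ℝ} (hf : ∀ y, 0 ≤ f y)
    {X : Set (Fin s → ℝ)} (hX : MeasurableSet X) (hfin : {y | logPoint ϖ y ∈ X}.Finite) :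
    pointMeasure ϖ f X = ENNReal.ofReal (∑ᶠ y ∈ {y | logPoint ϖ y ∈ X}, f y) := by
  rw [pointMeasure, Measure.sum_apply _ hX, finsum_mem_eq_finite_toFinset_sum _ hfin,
    ENNReal.ofReal_sum_of_nonneg fun y _ => hf y, tsum_eq_sum (s := hfin.toFinset)]
  · refine Finset.sum_congr rfl fun y hy => ?_
    have h : logPoint ϖ y ∈ X := by simpa using hy
    simp [Measure.dirac_apply' _ hX, h]
  · intro y hy
    have h : logPoint ϖ y ∉ X := by simpa using hy
    simp [Measure.dirac_apply' _ hX, h]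

lemma pointMeasure_real (ϖ : Fin s → ℝ) {f : (Fin s → ℕ+) → ℝ} (hf : ∀ y, 0 ≤ f y)
    {X : Set (Fin s → ℝ)} (hX : MeasurableSet X) (hfin : {y | logPoint ϖ y ∈ X}.Finite) :
    (pointMeasure ϖ f).real X = ∑ᶠ y ∈ {y | logPoint ϖ y ∈ X}, f y := by
  rw [Measure.real, pointMeasure_apply ϖ hf hX hfin, ENNReal.toReal_ofReal]
  exact finsum_nonneg fun y => finsum_nonneg fun _ => hf y

lemma logPoint_le_iff {ϖ : Fin s → ℝ} (hϖ : ∀ i, 0 < ϖ i) (b : Fin s → ℝ) (y : Fin s → ℕ+) :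
    logPoint ϖ y ∈ Set.Iic b ↔ ∀ i, ((y i : ℕ) : ℝ) ≤ Real.exp (b i / ϖ i) := by
  refine forall_congr' fun i => ?_
  have hy : (0 : ℝ) < ((y i : ℕ) : ℝ) := by exact_mod_cast (y i).pos
  rw [← Real.log_le_iff_le_exp hy, le_div_iff₀ (hϖ i), mul_comm]
  rfl

lemma finite_logPoint_le {ϖ : Fin s → ℝ} (hϖ : ∀ i, 0 < ϖ i) (b : Fin s → ℝ) :
    {y | logPoint ϖ y ∈ Set.Iic b}.Finite := by
  let m : Fin s → ℕ+ := fun i => ⟨⌊Real.exp (b i / ϖ i)⌋₊ + 1, Nat.succ_pos _⟩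
  refine (Set.finite_Iic m).subset fun y hy i => ?_
  have h1 := Nat.le_floor ((logPoint_le_iff hϖ b y).1 hy i)
  rw [← PNat.coe_le_coe]
  exact h1.trans (Nat.le_succ _)

lemma region_eq {α : Fin s → κ → ℝ} {ϖ : Fin s → ℝ} (hϖ : ∀ i, 0 < ϖ i) {B : ℝ} (hB : 0 < B) :
    region α B = {y | logPoint ϖ y ∈ polyhedron α ϖ fun _ => Real.log B} := by
  ext y
  have hy : ∀ i, (0 : ℝ) < ((y i : ℕ) : ℝ) := fun i => by exact_mod_cast (y i).pos
  have h : (∀ k, ∏ i, ((y i : ℕ) : ℝ) ^ α i k ≤ B) ↔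
      ∀ k, ∑ i, α i k * (ϖ i)⁻¹ * (ϖ i * Real.log (y i : ℕ)) ≤ Real.log B := by
    refine forall_congr' fun k => ?_
    rw [← Real.log_le_log_iff (Finset.prod_pos fun i _ => Real.rpow_pos_of_pos (hy i) _) hB,
      Real.log_prod fun i _ => (Real.rpow_pos_of_pos (hy i) _).ne']
    have h2 : ∀ i, α i k * (ϖ i)⁻¹ * (ϖ i * Real.log (y i : ℕ)) =
        Real.log (((y i : ℕ) : ℝ) ^ α i k) := fun i => by
      have := (hϖ i).ne'
      rw [Real.log_rpow (hy i)]
      field_simp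
    simp only [h2]
  exact ⟨fun hr => ⟨h.1 hr, fun i => mul_nonneg (hϖ i).le (Real.log_natCast_nonneg _)⟩,
    fun hr => h.2 hr.1⟩

/-- Property I in terms of the distribution function of `pointMeasure ϖ f`. -/
lemma abs_pointMeasure_Iic_sub_le {ϖ : Fin s → ℝ} (hs : 1 ≤ s) (hϖ : ∀ i, 0 < ϖ i) {Δ c w : ℝ}
    (hΔ : 0 ≤ Δ) (hc : 0 ≤ c) (hw : ∀ i, ϖ i ≤ w) {f : (Fin s → ℕ+) → ℝ} (hf : ∀ y, 0 ≤ f y)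
    {M E : ℝ} (hI : PropertyI ϖ Δ c f M E) {β : ℝ} {b : Fin s → ℝ} (hβ : 0 ≤ β)
    (hb : ∀ i, β ≤ b i) :
    |(pointMeasure ϖ f).real (Set.Iic b) - M * Real.exp (∑ i, b i)| ≤
      c * (E * Real.exp (∑ i, b i) * Real.exp (-(Δ / w * β))) := by
  obtain ⟨hM, hME, hI⟩ := hI
  have hE : 0 ≤ E := hM.trans hME
  have : Nonempty (Fin s) := ⟨⟨0, hs⟩⟩
  have hB : ∀ i, 1 ≤ Real.exp (b i / ϖ i) := fun i => by
    have := hϖ i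
    exact Real.one_le_exp (div_nonneg (hβ.trans (hb i)) this.le)
  have h1 := hI (fun i => Real.exp (b i / ϖ i)) hB
  have hset : {y : Fin s → ℕ+ | ∀ i, ((y i : ℕ) : ℝ) ≤ Real.exp (b i / ϖ i)} =
      {y | logPoint ϖ y ∈ Set.Iic b} := Set.ext fun y => (logPoint_le_iff hϖ b y).symm
  have hprod : ∏ i, Real.exp (b i / ϖ i) ^ ϖ i = Real.exp (∑ i, b i) := by
    rw [Real.exp_sum]
    refine Finset.prod_congr rfl fun i _ => ?_
    rw [← Real.exp_mul, div_mul_cancel₀ _ (hϖ i).ne']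
  rw [hset, hprod, ← pointMeasure_real ϖ hf measurableSet_Iic (finite_logPoint_le hϖ b)] at h1
  refine h1.trans ?_
  have hinf : Real.exp (β / w) ≤ ⨅ i, Real.exp (b i / ϖ i) := by
    refine le_ciInf fun i => Real.exp_le_exp.2 ?_
    have h2 := hϖ i
    exact (div_le_div_of_nonneg_left hβ h2 (hw i)).trans (by gcongr; exact hb i)
  have h2 : (⨅ i, Real.exp (b i / ϖ i)) ^ (-Δ) ≤ Real.exp (-(Δ / w * β)) := by
    refine (Real.rpow_le_rpow_of_nonpos (Real.exp_pos _) hinf (by linarith)).trans_eq ?_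
    rw [← Real.exp_mul]
    congr 1
    ring
  gcongr

end PointMeasure

lemma maxValue_pos_of_affineSpan_eq_top {s : ℕ} (hs : 1 ≤ s) {κ : Type*} {α : Fin s → κ → ℝ}
    {ϖ : Fin s → ℝ} (hbdd : Bornology.IsBounded (polyhedron α ϖ fun _ => 1))
    (hspan : affineSpan ℝ (polyhedron α ϖ fun _ => 1) = ⊤) :
    0 < maxValue (polyhedron α ϖ fun _ => 1) := by
  have hcomp := Metric.isCompact_of_isClosed_isBounded (isClosed_polyhedron _ _ _) hbdd
  obtain ⟨-, -, -, hmax⟩ := exists_isMaxOn_of_isCompact hcomp ⟨0, zero_mem_polyhedron_one α ϖ⟩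
  by_contra hcon
  have h0 : polyhedron α ϖ (fun _ => 1) ⊆ {0} := by
    intro t ht
    have h1 : ∑ i, t i = 0 :=
      le_antisymm ((hmax t ht).trans (not_lt.1 hcon)) (Finset.sum_nonneg fun i _ => ht.2 i)
    have h2 := (Finset.sum_eq_zero_iff_of_nonneg fun i _ => ht.2 i).1 h1
    exact funext fun i => h2 i (Finset.mem_univ i)
  have h1 := affineSpan_mono ℝ h0
  rw [hspan, top_le_iff] at h1
  have h2 : (fun _ => 1 : Fin s → ℝ) ∈ affineSpan ℝ ({0} : Set (Fin s → ℝ)) := by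
    rw [h1]; exact AffineSubspace.mem_top _ _ _
  rw [AffineSubspace.mem_affineSpan_singleton] at h2
  simpa using congrFun h2 ⟨0, hs⟩

lemma eq_of_abs_sub_mul_le {V : ℝ → ℝ} {F₁ F₂ C₁ C₂ a : ℝ} {k : ℕ}
    (h₁ : ∀ L, 0 < L →
      |V L - F₁ * (L ^ k * Real.exp (a * L))| ≤ C₁ * (L ^ k / L * Real.exp (a * L)))
    (h₂ : ∀ L, 0 < L →
      |V L - F₂ * (L ^ k * Real.exp (a * L))| ≤ C₂ * (L ^ k / L * Real.exp (a * L))) :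
    F₁ = F₂ := by
  by_contra hne
  have hd : 0 < |F₁ - F₂| := abs_pos.2 (sub_ne_zero.2 hne)
  set L : ℝ := (|C₁ + C₂| + 1) / |F₁ - F₂|
  have hL : 0 < L := by positivity
  set Ψ := L ^ k * Real.exp (a * L)
  have hΨ : 0 < Ψ := by positivity
  have hΦ : L ^ k / L * Real.exp (a * L) = Ψ / L := by simp only [Ψ]; ring
  have h1 := h₁ L hL
  have h2 := h₂ L hL
  rw [hΦ] at h1 h2
  have h3 : |F₁ - F₂| * Ψ ≤ (C₁ + C₂) * (Ψ / L) := by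
    calc |F₁ - F₂| * Ψ = |(V L - F₂ * Ψ) - (V L - F₁ * Ψ)| := by
          rw [← abs_of_pos hΨ, ← abs_mul, abs_of_pos hΨ]; congr 1; ring
      _ ≤ |V L - F₂ * Ψ| + |V L - F₁ * Ψ| := abs_sub _ _
      _ ≤ _ := by linarith
  have h4 : |F₁ - F₂| * L ≤ C₁ + C₂ := by
    have h5 := mul_le_mul_of_nonneg_right h3 hL.le
    have h6 : (C₁ + C₂) * (Ψ / L) * L = (C₁ + C₂) * Ψ := by field_simp
    rw [h6] at h5
    have h7 : |F₁ - F₂| * L * Ψ ≤ (C₁ + C₂) * Ψ := by linarith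
    exact le_of_mul_le_mul_right h7 hΨ
  have h8 : |F₁ - F₂| * L = |C₁ + C₂| + 1 := by simp only [L]; field_simp
  linarith [le_abs_self (C₁ + C₂)]

/-- The slice constant exists, and it also is the leading constant of the exponential measure of the
dilates of the polytope. Since that measure does not refer to the coordinate that is forgotten in
`sliceMeasure`, neither does the constant. -/
lemma exists_isSliceConstant {s : ℕ} (hs : 1 ≤ s) {κ : Type*} [Fintype κ] (α : Fin s → κ → ℝ)
    (ϖ : Fin s → ℝ) (hbdd : Bornology.IsBounded (polyhedron α ϖ fun _ => 1)) :
    ∃ c C : ℝ, IsSliceConstant (polyhedron α ϖ fun _ => 1) c ∧ ∀ L, 0 < L →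
      |(expMeasure (Fin s)).real (polyhedron α ϖ fun _ => L) -
          (s - 1 - maxFaceDim (polyhedron α ϖ fun _ => 1)).factorial * c *
            (L ^ maxFaceDim (polyhedron α ϖ fun _ => 1) *
              Real.exp (maxValue (polyhedron α ϖ fun _ => 1) * L))| ≤
        C * (L ^ maxFaceDim (polyhedron α ϖ fun _ => 1) / L *
          Real.exp (maxValue (polyhedron α ϖ fun _ => 1) * L)) := by
  have hsl := fun i₀ => (exists_slice_asymptotic α ϖ hbdd i₀).2
  choose c C hC hsl using hsl
  have hexp := fun i₀ => exists_expMeasure_asymptotic α ϖ hbdd i₀ (hsl i₀)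
  choose C' hexp using hexp
  have hk := (exists_slice_asymptotic α ϖ hbdd ⟨0, hs⟩).1
  have hcc : ∀ i, c i = c ⟨0, hs⟩ := by
    intro i
    have h1 := eq_of_abs_sub_mul_le (hexp i) (hexp ⟨0, hs⟩)
    exact mul_left_cancel₀ (by positivity) h1
  refine ⟨c ⟨0, hs⟩, C' ⟨0, hs⟩, ⟨∑ i, C i, 1, one_pos, fun i₀ δ hδ _ => ?_⟩, hexp ⟨0, hs⟩⟩
  have h1 := hsl i₀ δ hδ
  rw [hcc i₀] at h1
  rw [sliceMeasure, image_restrict_slice]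
  refine h1.trans ?_
  have h2 : s - 1 - maxFaceDim (polyhedron α ϖ fun _ => 1) + 1 =
      s - maxFaceDim (polyhedron α ϖ fun _ => 1) := by omega
  rw [h2]
  gcongr
  exact Finset.single_le_sum (fun i _ => hC i) (Finset.mem_univ i₀)

end HyperbolaMethod

theorem theorem1p1 {κ : Type*} [Fintype κ] (s : ℕ) (hs : 1 ≤ s)
    (α : Fin s → κ → ℝ) (hα : ∀ i k, 0 ≤ α i k)
    (ϖ : Fin s → ℝ) (hϖ : ∀ i, 0 < ϖ i)
    (Δ D ν c : ℝ) (hΔ : 0 < Δ) (hD : 0 < D) (hν : 0 < ν) (hc : 0 < c)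
    (P : Set (Fin s → ℝ)) (hP : P = polyhedron α ϖ (fun _ => 1))
    (hbdd : Bornology.IsBounded P) (hnondeg : affineSpan ℝ P = ⊤)
    (hface : ∀ i, ¬ maxFace P ⊆ {t | t i = 0})
    (a : ℝ) (ha : a = maxValue P) (k : ℕ) (hk : k = maxFaceDim P) :
    ∃ cP : ℝ, IsSliceConstant P cP ∧
      ∃ N₀ : ℝ, ∀ N : ℝ, N₀ ≤ N → ∀ C₁₀ : ℝ, N * s < C₁₀ → FaceAssumption α ϖ N C₁₀ →
        ∃ C B₀ : ℝ, ∀ (f : (Fin s → ℕ+) → ℝ) (CM CE : ℝ)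
          (CMI : (I : Finset (Fin s)) → (I → ℕ+) → ℝ),
          (∀ y, 0 ≤ f y) → PropertyI ϖ Δ c f CM CE → PropertyII ϖ Δ D ν c f CE CMI →
          ConstantsBound D CE CMI →
          ∀ B : ℝ, B₀ ≤ B →
            (region α B).Finite ∧
            |(∑ᶠ y ∈ region α B, f y)
                - ((s - 1 - k).factorial : ℝ) * CM * cP * Real.log B ^ k * B ^ a|
              ≤ C * (CE * Real.log (Real.log B) ^ s * Real.log B ^ ((k : ℤ) - 1) * B ^ a) := by
  subst hP
  obtain ⟨cP, C₀, hcP, hV⟩ := exists_isSliceConstant hs α ϖ hbdd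
  have hpos := maxValue_pos_of_affineSpan_eq_top hs hbdd hnondeg
  rw [← ha, ← hk] at hV
  refine ⟨cP, hcP, ?_⟩
  have hw : ∀ i, ϖ i ≤ ∑ i, ϖ i := fun i =>
    Finset.single_le_sum (fun i _ => (hϖ i).le) (Finset.mem_univ i)
  set w := ∑ i, ϖ i
  have hw0 : 0 < w := (hϖ ⟨0, hs⟩).trans_le (hw _)
  -- Coordinates `y i` with `ϖ i * log (y i) ≤ A * log log B` count as small.
  set A : ℝ := (2 * s + 1) / (Δ / w)
  have hA : 0 < A := by positivity
  have hΔA : 2 * s + 1 ≤ Δ / w * A := by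
    rw [mul_div_cancel₀ _ (by positivity)]
  refine ⟨A + 2 + ∑ i, A / ϖ i, fun N hN C₁₀ hC₁₀ hFA => ?_⟩
  have hAϖ : ∀ i, 0 ≤ A / ϖ i := fun i => div_nonneg hA.le (hϖ i).le
  have hN1 : A + 2 ≤ N := by
    have := Finset.sum_nonneg fun i (_ : i ∈ Finset.univ) => hAϖ i
    linarith
  have hN2 : ∀ i, A ≤ N * ϖ i := by
    intro i
    have h1 := Finset.single_le_sum (fun i _ => hAϖ i) (Finset.mem_univ i)
    have h2 : A / ϖ i ≤ N := by linarith
    rwa [div_le_iff₀ (hϖ i)] at h2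
  have hs' : (1 : ℝ) ≤ s := by exact_mod_cast hs
  have hC : s * A + s + 1 ≤ C₁₀ := by nlinarith
  obtain ⟨C, hmain⟩ := exists_measureReal_polyhedron_asymptotic hα hϖ hbdd hpos hA.le hN2 hC hFA
    hΔA hc.le (by rw [← ha, ← hk]; exact hV)
  rw [← ha, ← hk] at hmain
  obtain ⟨L₀, hL₀⟩ := Filter.eventually_atTop.1 (hmain.and (Filter.eventually_gt_atTop 0))
  refine ⟨C, Real.exp L₀, fun f CM CE _ hf hI _ _ B hB => ?_⟩
  have hB0 : 0 < B := (Real.exp_pos _).trans_le hB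
  have hLB : L₀ ≤ Real.log B := by rwa [Real.le_log_iff_exp_le hB0]
  obtain ⟨hL, hL0⟩ := hL₀ _ hLB
  set L := Real.log B
  obtain ⟨R, -, hbox⟩ := exists_polyhedron_box hbdd
  have hfin : {y | logPoint ϖ y ∈ polyhedron α ϖ fun _ => L}.Finite :=
    (finite_logPoint_le hϖ fun _ => R * L).subset fun y hy i => hbox L hL0 _ hy i
  have hreg : region α B = {y | logPoint ϖ y ∈ polyhedron α ϖ fun _ => L} := region_eq hϖ hB0
  refine ⟨hreg ▸ hfin, ?_⟩
  have h1 := hL (pointMeasure ϖ f) CM CE hI.1 hI.2.1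
    (fun b => by
      rw [pointMeasure_apply ϖ hf measurableSet_Iic (finite_logPoint_le hϖ b)]
      exact ENNReal.ofReal_ne_top)
    (fun β b hβ hb => abs_pointMeasure_Iic_sub_le hs hϖ hΔ.le hc.le hw hf hI hβ hb)
  rw [pointMeasure_real ϖ hf (isClosed_polyhedron _ _ _).measurableSet hfin, ← hreg] at h1
  have hBa : B ^ a = Real.exp (a * L) := by rw [Real.rpow_def_of_pos hB0, mul_comm]
  have hz : L ^ ((k : ℤ) - 1) = L ^ k / L := by
    rw [zpow_sub_one₀ hL0.ne', zpow_natCast, div_eq_mul_inv]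
  rw [hBa, hz]
  refine (le_of_eq ?_).trans (h1.trans_eq ?_)
  · congr 2; ring
  · ring
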